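/- **Setting.** Let $d\ge 1$, let $\mathbf z$ be a random vector with $d$-dimensional subvector $\mathbf w$, and let $\mathbf z_1,\mathbf z_2$ be independent copies of $\mathbf z$, with subvectors $\mathbf w_1,\mathbf w_2$. Let $\mathcal W$ be the (closed) support of $\mathbf w$. Conditional expectations are computed from a fixed regular conditional distribution of $\mathbf z$ given $\mathbf w$. Limits in the value of $\mathbf w_2$ are taken inside $\mathcal W$. Let $\Theta\subseteq\mathbb R^k$, $\boldsymbol\theta_0\in\mathbb R^k$, and let $m(\cdot,\cdot;\boldsymbol\theta)\in\mathbb R$, $\mathbf s(\cdot,\cdot;\boldsymbol\theta)\in\mathbb R^k$, $\mathbf H(\cdot,\cdot;\boldsymbol\theta,\mathbf t)\in\mathbb R^{k\times k}$ be measurable. For $h>0$ put $K_h(\mathbf u)=h^{-d}K(\mathbf u/h)$ and $$M(\boldsymbol\theta;h)=\mathbb E[m(\mathbf z_1,\mathbf z_2;\boldsymbol\theta)K_h(\mathbf w_1-\mathbf w_2)].$$ **Assumption 1.** (i) $K$ is a symmetric ($K(-\mathbf u)=K(\mathbf u)$), bounded probability density on $\mathbb R^d$. (ii) $\Theta$ is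 convex, $m(\cdot,\cdot;\boldsymbol\theta)$ is permutation symmetric for $\boldsymbol\theta\in\Theta$, and $\boldsymbol\theta\mapsto m(\mathbf z_1,\mathbf z_2;\boldsymbol\theta)$ is convex on $\Theta$ with probability one. (iii) $\mathbf w$ has a Lebesgue density $f_{\mathbf w}$, which is bounded and continuous on $\mathcal W$ and zero off $\mathcal W$. (iv) For each $\boldsymbol\theta\in\Theta$, $m(\mathbf z_1,\mathbf z_2;\boldsymbol\theta)$ is integrable, the positive part of $\sup_{\mathbf v\in\mathcal W}\mathbb E[m(\mathbf z_1,\mathbf z_2;\boldsymbol\theta)|\mathbf w_1=\mathbf w,\mathbf w_2=\mathbf v]f_{\mathbf w}(\mathbf v)$ has finite expectation, and, with probability one, $$\lim_{\mathbf u\to\mathbf 0}\mathbb E[m(\mathbf z_1,\mathbf z_2;\boldsymbol\theta)|\mathbf w_1=\mathbf w,\mathbf w_2=\mathbf w+\mathbf u]=\mathbb E[m(\mathbf z_1,\mathbf z_2;\boldsymbol\theta)|\mathbf w_1=\mathbf w,\mathbf w_2=\mathbf w].$$ (v) On $\Theta$ the function $M_0(\boldsymbol\theta)=\int_{\mathcal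 W}\mathbb E[m(\mathbf z_1,\mathbf z_2;\boldsymbol\theta)|\mathbf w_1=\mathbf w,\mathbf w_2=\mathbf w]f_{\mathbf w}(\mathbf w)^2d\mathbf w$ is well defined and finite, and it is uniquely minimized at $\boldsymbol\theta_0$, an interior point of $\Theta$. **Assumption 2.** For $\mathbf t\in\mathbb R^k$ put $$r_{\mathbf t}(\boldsymbol\theta,\tau)=\frac{m(\mathbf z_1,\mathbf z_2;\boldsymbol\theta+\mathbf t\tau)-m(\mathbf z_1,\mathbf z_2;\boldsymbol\theta)}{\tau}-\mathbf s(\mathbf z_1,\mathbf z_2;\boldsymbol\theta)'\mathbf t,\qquad R_{\mathbf t}(\boldsymbol\theta,\tau)=\frac{\mathbb E[r_{\mathbf t}(\boldsymbol\theta,\tau)|\mathbf w_1,\mathbf w_2]}{\tau}-\tfrac12\mathbf t'\mathbf H(\mathbf w_1,\mathbf w_2;\boldsymbol\theta,\mathbf t)\mathbf t .$$ (i) For each $\mathbf t$ there is $\delta>0$ such that, with suprema over $\tau\in(0,\delta)$, $\|\boldsymbol\theta-\boldsymbol\theta_0\|<\delta$, $\mathbf w_2\in\mathcal W$, the expectations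 $$\mathbb E\big[\sup|\mathbb E[r_{\mathbf t}(\boldsymbol\theta,\tau)|\mathbf z_1,\mathbf w_2]|f_{\mathbf w}(\mathbf w_2)^2\big],\quad \mathbb E\big[\sup\mathbb E[r_{\mathbf t}(\boldsymbol\theta,\tau)^2|\mathbf w_1,\mathbf w_2]f_{\mathbf w}(\mathbf w_2)\big],\quad \mathbb E\big[\sup|R_{\mathbf t}(\boldsymbol\theta,\tau)|f_{\mathbf w}(\mathbf w_2)\big]$$ are finite; and, with probability one, $\mathbb E[r_{\mathbf t}(\boldsymbol\theta,\tau)|\mathbf z_1=\mathbf z,\mathbf w_2=\mathbf w+\mathbf u]$, $\mathbb E[r_{\mathbf t}(\boldsymbol\theta,\tau)^2|\mathbf w_1=\mathbf w,\mathbf w_2=\mathbf w+\mathbf u]$ and $\mathbb E[R_{\mathbf t}(\boldsymbol\theta,\tau)|\mathbf w_1=\mathbf w,\mathbf w_2=\mathbf w+\mathbf u]$ tend to $0$ as $\tau\downarrow0$, $(\boldsymbol\theta,\mathbf u)\to(\boldsymbol\theta_0,\mathbf 0)$. (ii) There are $\delta>0$ and a function $b$ such that, with probability one, $\sup_{\|\boldsymbol\theta-\boldsymbol\theta_0\|<\delta}\|\mathbf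 s(\mathbf z_1,\mathbf z_2;\boldsymbol\theta)\|\le b(\mathbf z_1)b(\mathbf z_2)$, with $\mathbb E[b(\mathbf z)^4]+\sup_{\mathbf w\in\mathcal W}\mathbb E[b(\mathbf z)^4|\mathbf w]f_{\mathbf w}(\mathbf w)<\infty$ and $\mathbb E[\sup_{\|\boldsymbol\theta-\boldsymbol\theta_0\|<\delta,\mathbf w_2\in\mathcal W}\|\mathbf H(\mathbf w_1,\mathbf w_2;\boldsymbol\theta,\mathbf t)\|f_{\mathbf w}(\mathbf w_2)]<\infty$ for each $\mathbf t$. (iii) There are functions $\mathbf G_0,\boldsymbol\xi_0,\boldsymbol\Xi_0$ such that, for each $\mathbf t$ and with probability one, $$\lim_{(\boldsymbol\theta,\mathbf u)\to(\boldsymbol\theta_0,\mathbf 0)}\mathbf H(\mathbf w,\mathbf w+\mathbf u;\boldsymbol\theta,\mathbf t)f_{\mathbf w}(\mathbf w)=\mathbf G_0(\mathbf w),$$ $$\lim_{(\boldsymbol\theta,\mathbf u)\to(\boldsymbol\theta_0,\mathbf 0)}2\,\mathbb E[\mathbf s(\mathbf z_1,\mathbf z_2;\boldsymbol\theta)|\mathbf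 z_1=\mathbf z,\mathbf w_2=\mathbf w+\mathbf u]f_{\mathbf w}(\mathbf w)=\boldsymbol\xi_0(\mathbf z),$$ $$\lim_{(\boldsymbol\theta,\bar{\boldsymbol\theta},\mathbf u)\to(\boldsymbol\theta_0,\boldsymbol\theta_0,\mathbf 0)}\mathbb E[\mathbf s(\mathbf z_1,\mathbf z_2;\boldsymbol\theta)\mathbf s(\mathbf z_1,\mathbf z_2;\bar{\boldsymbol\theta})'|\mathbf w_1=\mathbf w,\mathbf w_2=\mathbf w+\mathbf u]f_{\mathbf w}(\mathbf w)=\boldsymbol\Xi_0(\mathbf w).$$ (iv) $\mathbb E[\mathbf G_0(\mathbf w)]$, $\mathbb E[\boldsymbol\xi_0(\mathbf z)\boldsymbol\xi_0(\mathbf z)']$ and $\mathbb E[\boldsymbol\Xi_0(\mathbf w)]$ exist and are positive definite. **Proposition.** Suppose Assumptions 1 and 2 hold and that (i) $\int_{\mathbb R^d}\|\mathbf u\|^2K(\mathbf u)\,d\mathbf u<\infty$, and (ii) with probability one, $\mathbf v\mapsto\boldsymbol\psi(\mathbf w,\mathbf v)=\mathbb E[\mathbf s(\mathbf z_1,\mathbf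 z_2;\boldsymbol\theta_0)|\mathbf w_1=\mathbf w,\mathbf w_2=\mathbf v]f_{\mathbf w}(\mathbf v)$ (which is zero for $\mathbf v\notin\mathcal W$) is twice continuously differentiable on $\mathbb R^d$, with $\mathbb E[\sup_{\mathbf v\in\mathcal W}\|\partial_{\mathbf v}^{\boldsymbol\alpha}\boldsymbol\psi(\mathbf w,\mathbf v)\|]<\infty$ for all multi-indices $\boldsymbol\alpha\in\mathbb Z_+^d$ with $|\boldsymbol\alpha|\le2$. Then $\operatorname{argmin}_{\boldsymbol\theta\in\Theta}M(\boldsymbol\theta;h)$ is non-empty for all sufficiently small $h>0$, and there is $\mathbf b_2\in\mathbb R^k$ such that every choice of $\boldsymbol\theta(h)\in\operatorname{argmin}_{\boldsymbol\theta\in\Theta}M(\boldsymbol\theta;h)$ (for $h>0$ near zero) satisfies $$\boldsymbol\theta(h)-\boldsymbol\theta_0=\mathbf b_2h^2+o(h^2)\qquad\text{as }h\downarrow0 .$$ -/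

import Mathlib

open MeasureTheory ProbabilityTheory Filter Topology
open scoped ENNReal Asymptotics

noncomputable section

namespace PairwiseDiff

/-- `ℝⁿ` with the Euclidean norm. -/
abbrev RVec (n : ℕ) : Type := EuclideanSpace ℝ (Fin n)

/-- The expectation under `μ` of the `[0, ∞]`-valued function `g` is finite. As `g` may be a supremum
over an uncountable family, this is phrased through a measurable majorant; for an
a.e.-measurable `g` it says exactly that `∫⁻ g ∂μ < ∞`. -/
def FiniteMean {α : Type*} [MeasurableSpace α] (μ : Measure α) (g : α → ℝ≥0∞) : Prop :=
  ∃ G : α → ℝ≥0∞, Measurable G ∧ (∀ᵐ x ∂μ, g x ≤ G x) ∧ ∫⁻ x, G x ∂μ < ∞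

/-- The Frobenius norm of a matrix. -/
def matNorm {k : ℕ} (A : Matrix (Fin k) (Fin k) ℝ) : ℝ := √(∑ i, ∑ j, A i j ^ 2)

/-- The quadratic form `t' A t`. -/
def quadForm {k : ℕ} (A : Matrix (Fin k) (Fin k) ℝ) (t : RVec k) : ℝ :=
  ∑ i, ∑ j, t i * A i j * t j

/-- The partial derivative `∂ⁿ g / ∂v_{i 0} ⋯ ∂v_{i (n - 1)}` at `v`. For a function of class `Cⁿ` these
are, over all `i : Fin n → Fin d`, the derivatives `∂^α g` with `|α| = n`. -/
def partialDeriv {d k n : ℕ} (i : Fin n → Fin d) (g : RVec d → RVec k) (v : RVec d) : RVec k :=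
  iteratedFDeriv ℝ n g v (fun l => EuclideanSpace.single (i l) (1 : ℝ))

/-- The distribution of a random vector `z` with values in `Z`, together with its `d`-dimensional
subvector `w`, a Lebesgue density `f` of `w` (zero off the support of `w`), and a regular conditional
distribution `κ` of `z` given `w`. -/
structure Population (d : ℕ) (Z : Type*) [MeasurableSpace Z] where
  /-- the law of `z` -/
  P : Measure Z
  isProbabilityMeasure : IsProbabilityMeasure P
  /-- the subvector `w` of `z` -/
  w : Z → RVec d
  measurable_w : Measurable w
  /-- the Lebesgue density of `w` -/
  f : RVec d → ℝ
  measurable_f : Measurable f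
  f_nonneg : ∀ a, 0 ≤ f a
  law_w : P.map w = volume.withDensity (fun a => ENNReal.ofReal (f a))
  f_eq_zero : ∀ a, a ∉ (P.map w).support → f a = 0
  /-- a regular conditional distribution of `z` given `w` -/
  κ : Kernel (RVec d) Z
  isMarkovKernel : IsMarkovKernel κ
  disintegration : P.map (fun z => (w z, z)) = (P.map w) ⊗ₘ κ

namespace Population

variable {d k : ℕ} {Z : Type*} [MeasurableSpace Z] (D : Population d Z)

/-- The law of `w`. -/
def lawW : Measure (RVec d) := D.P.map D.w

/-- The support `𝒲` of `w`. -/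
def supp : Set (RVec d) := D.lawW.support

/-- The joint law of two independent copies `z₁, z₂` of `z`. -/
def pairLaw : Measure (Z × Z) := D.P.prod D.P

/-- The joint law of `z₁, z₂` conditional on `w₁ = a`, `w₂ = v`. -/
def condPairLaw (a v : RVec d) : Measure (Z × Z) := (D.κ a).prod (D.κ v)

/-- `E[g(z₁, z₂) | w₁ = a, w₂ = v]`. -/
def condPair {E : Type*} [NormedAddCommGroup E] [NormedSpace ℝ E] (g : Z → Z → E)
    (a v : RVec d) : E :=
  ∫ p, g p.1 p.2 ∂(D.condPairLaw a v)

/-- `E[g(z₁, z₂) | z₁ = x, w₂ = v]`. -/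
def condFst {E : Type*} [NormedAddCommGroup E] [NormedSpace ℝ E] (g : Z → Z → E)
    (x : Z) (v : RVec d) : E :=
  ∫ y, g x y ∂(D.κ v)

/-- `E[g(z₁, z₂)² | w₁ = a, w₂ = v]`, with value in `[0, ∞]`. -/
def condSq (g : Z → Z → ℝ) (a v : RVec d) : ℝ≥0∞ :=
  ∫⁻ p, ENNReal.ofReal (g p.1 p.2 ^ 2) ∂(D.condPairLaw a v)

/-- The objective `M(θ; h) = E[m(z₁, z₂; θ) K_h(w₁ - w₂)]` with `K_h(u) = h⁻ᵈ K(u / h)`. -/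
def M (m : Z → Z → RVec k → ℝ) (K : RVec d → ℝ) (θ : RVec k) (h : ℝ) : ℝ :=
  ∫ p, m p.1 p.2 θ * ((h ^ d)⁻¹ * K (h⁻¹ • (D.w p.1 - D.w p.2))) ∂D.pairLaw

/-- The set `argmin_{θ ∈ Θ} M(θ; h)`. -/
def argminM (m : Z → Z → RVec k → ℝ) (Θ : Set (RVec k)) (K : RVec d → ℝ) (h : ℝ) :
    Set (RVec k) :=
  {θ | θ ∈ Θ ∧ ∀ θ' ∈ Θ, D.M m K θ h ≤ D.M m K θ' h}

/-- The integrand `E[m(z₁, z₂; θ) | w₁ = a, w₂ = a] f(a)²` of `M₀(θ)`. -/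
def M₀Integrand (m : Z → Z → RVec k → ℝ) (θ : RVec k) (a : RVec d) : ℝ :=
  D.condPair (fun x y => m x y θ) a a * D.f a ^ 2

/-- The limiting objective `M₀(θ)`. -/
def M₀ (m : Z → Z → RVec k → ℝ) (θ : RVec k) : ℝ :=
  ∫ a in D.supp, D.M₀Integrand m θ a

/-- The function `ψ(a, v) = E[s(z₁, z₂; θ₀) | w₁ = a, w₂ = v] f(v)`. -/
def ψ (s : Z → Z → RVec k → RVec k) (θ₀ : RVec k) (a v : RVec d) : RVec k :=
  D.f v • D.condPair (fun x y => s x y θ₀) a v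

/-- The remainder `R_t(θ, τ)` as a function of `w₁ = a`, `w₂ = v`, where `r θ τ` is the remainder
`r_t(θ, τ)` as a function of `z₁, z₂`. -/
def remR (r : RVec k → ℝ → Z → Z → ℝ)
    (H : RVec d → RVec d → RVec k → RVec k → Matrix (Fin k) (Fin k) ℝ)
    (t θ : RVec k) (τ : ℝ) (a v : RVec d) : ℝ :=
  D.condPair (r θ τ) a v / τ - 1 / 2 * quadForm (H a v θ t) t

end Population

/-- The remainder `r_t(θ, τ)` as a function of `z₁, z₂`. -/
def remr {k : ℕ} {Z : Type*} (m : Z → Z → RVec k → ℝ) (s : Z → Z → RVec k → RVec k)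
    (t θ : RVec k) (τ : ℝ) (x y : Z) : ℝ :=
  (m x y (θ + τ • t) - m x y θ) / τ - inner ℝ (s x y θ) t

/-- The filter `τ ↓ 0`, `(θ, v) → (θ₀, a)` with `v` in `S`. -/
def limTauThetaV {d k : ℕ} (S : Set (RVec d)) (θ₀ : RVec k) (a : RVec d) :
    Filter (ℝ × RVec k × RVec d) :=
  𝓝[>] (0 : ℝ) ×ˢ (𝓝 θ₀ ×ˢ 𝓝[S] a)

/-- The (punctured) filter `(θ, v) → (θ₀, a)` with `v` in `S`. -/
def limThetaV {d k : ℕ} (S : Set (RVec d)) (θ₀ : RVec k) (a : RVec d) :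
    Filter (RVec k × RVec d) :=
  𝓝[{q | q.2 ∈ S ∧ q ≠ (θ₀, a)}] (θ₀, a)

/-- The (punctured) filter `(θ, θ', v) → (θ₀, θ₀, a)` with `v` in `S`. -/
def limThetaThetaV {d k : ℕ} (S : Set (RVec d)) (θ₀ : RVec k) (a : RVec d) :
    Filter (RVec k × RVec k × RVec d) :=
  𝓝[{q | q.2.2 ∈ S ∧ q ≠ (θ₀, θ₀, a)}] (θ₀, θ₀, a)

/-- Conditions under which `M(θ; h)` converges to `M₀(θ)` as `h ↓ 0`. Limits in `w₂` are
taken inside the support of `w`, outside of which there is no conditional expectation. -/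
structure ConvergenceOfM {d k : ℕ} {Z : Type*} [MeasurableSpace Z] (D : Population d Z)
    (m : Z → Z → RVec k → ℝ) (Θ : Set (RVec k)) (K : RVec d → ℝ) (θ₀ : RVec k) : Prop where
  -- the kernel is a symmetric, bounded probability density
  K_symm : ∀ u, K (-u) = K u
  K_bounded : ∃ C : ℝ, ∀ u, K u ≤ C
  K_nonneg : ∀ u, 0 ≤ K u
  K_measurable : Measurable K
  K_integral : ∫⁻ u, ENNReal.ofReal (K u) = 1
  -- convexity and permutation symmetry
  Θ_convex : Convex ℝ Θ
  m_measurable : ∀ θ ∈ Θ, Measurable (fun p : Z × Z => m p.1 p.2 θ)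
  m_symm : ∀ θ ∈ Θ, ∀ x y, m x y θ = m y x θ
  m_convex : ∀ᵐ p ∂D.pairLaw, ConvexOn ℝ Θ (m p.1 p.2)
  -- the density of `w` is bounded, and continuous on the support of `w`
  f_bounded : ∃ C : ℝ, ∀ a, D.f a ≤ C
  f_continuousOn : ContinuousOn D.f D.supp
  -- moments and continuity at the diagonal
  m_integrable : ∀ θ ∈ Θ, Integrable (fun p : Z × Z => m p.1 p.2 θ) D.pairLaw
  m_sup : ∀ θ ∈ Θ, FiniteMean D.lawW (fun a => ⨆ v ∈ D.supp,
    ENNReal.ofReal (D.condPair (fun x y => m x y θ) a v * D.f v))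
  m_lim : ∀ θ ∈ Θ, ∀ᵐ a ∂D.lawW,
    Tendsto (fun v => D.condPair (fun x y => m x y θ) a v) (𝓝[D.supp] a)
      (𝓝 (D.condPair (fun x y => m x y θ) a a))
  -- `M₀` is well defined, and uniquely minimized over `Θ` at an interior point `θ₀`
  M₀_integrable : ∀ θ ∈ Θ, IntegrableOn (D.M₀Integrand m θ) D.supp
  θ₀_interior : θ₀ ∈ interior Θ
  θ₀_unique_min : ∀ θ ∈ Θ, θ ≠ θ₀ → D.M₀ m θ₀ < D.M₀ m θ

/-- Existence of the limits `G₀`, `ξ₀`, `Ξ₀`, with `E[G₀(w)]`, `E[ξ₀(z) ξ₀(z)']` and `E[Ξ₀(w)]`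
positive definite. -/
structure VarianceIngredients {d k : ℕ} {Z : Type*} [MeasurableSpace Z] (D : Population d Z)
    (s : Z → Z → RVec k → RVec k)
    (H : RVec d → RVec d → RVec k → RVec k → Matrix (Fin k) (Fin k) ℝ) (θ₀ : RVec k)
    (G₀ : RVec d → Matrix (Fin k) (Fin k) ℝ) (ξ₀ : Z → RVec k)
    (Ξ₀ : RVec d → Matrix (Fin k) (Fin k) ℝ) : Prop where
  G₀_lim : ∀ t : RVec k, ∀ᵐ a ∂D.lawW,
    Tendsto (fun q : RVec k × RVec d => D.f a • H a q.2 q.1 t) (limThetaV D.supp θ₀ a) (𝓝 (G₀ a))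
  ξ₀_lim : ∀ᵐ z ∂D.P,
    Tendsto (fun q : RVec k × RVec d =>
        (2 * D.f (D.w z)) • D.condFst (fun x y => s x y q.1) z q.2)
      (limThetaV D.supp θ₀ (D.w z)) (𝓝 (ξ₀ z))
  Ξ₀_lim : ∀ᵐ a ∂D.lawW,
    Tendsto (fun q : RVec k × RVec k × RVec d =>
        D.f a • (Matrix.of fun i j : Fin k =>
          D.condPair (fun x y => s x y q.1 i * s x y q.2.1 j) a q.2.2))
      (limThetaThetaV D.supp θ₀ a) (𝓝 (Ξ₀ a))
  G₀_integrable : ∀ i j, Integrable (fun a => G₀ a i j) D.lawW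
  ξ₀_integrable : ∀ i j, Integrable (fun z => ξ₀ z i * ξ₀ z j) D.P
  Ξ₀_integrable : ∀ i j, Integrable (fun a => Ξ₀ a i j) D.lawW
  Γ₀_posDef : (Matrix.of fun i j : Fin k => ∫ a, G₀ a i j ∂D.lawW).PosDef
  Sigma₀_posDef : (Matrix.of fun i j : Fin k => ∫ z, ξ₀ z i * ξ₀ z j ∂D.P).PosDef
  EΞ₀_posDef : (Matrix.of fun i j : Fin k => ∫ a, Ξ₀ a i j ∂D.lawW).PosDef

/-- Conditions on the derivative-like functions `s` and `H`. -/
structure DerivativeConditions {d k : ℕ} {Z : Type*} [MeasurableSpace Z] (D : Population d Z)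
    (m : Z → Z → RVec k → ℝ) (s : Z → Z → RVec k → RVec k)
    (H : RVec d → RVec d → RVec k → RVec k → Matrix (Fin k) (Fin k) ℝ) (θ₀ : RVec k) : Prop where
  s_measurable : ∀ θ, Measurable (fun p : Z × Z => s p.1 p.2 θ)
  H_measurable : ∀ θ t i j, Measurable (fun q : RVec d × RVec d => H q.1 q.2 θ t i j)
  -- domination of the remainders
  rem_sup : ∀ t : RVec k, ∃ δ : ℝ, 0 < δ ∧
    FiniteMean D.P (fun z => ⨆ τ ∈ Set.Ioo 0 δ, ⨆ θ ∈ Metric.ball θ₀ δ, ⨆ v ∈ D.supp,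
      ENNReal.ofReal (|D.condFst (remr m s t θ τ) z v| * D.f v ^ 2)) ∧
    FiniteMean D.lawW (fun a => ⨆ τ ∈ Set.Ioo 0 δ, ⨆ θ ∈ Metric.ball θ₀ δ, ⨆ v ∈ D.supp,
      D.condSq (remr m s t θ τ) a v * ENNReal.ofReal (D.f v)) ∧
    FiniteMean D.lawW (fun a => ⨆ τ ∈ Set.Ioo 0 δ, ⨆ θ ∈ Metric.ball θ₀ δ, ⨆ v ∈ D.supp,
      ENNReal.ofReal (|D.remR (remr m s t) H t θ τ a v| * D.f v))
  -- the remainders vanish in the limit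
  rem_lim_fst : ∀ t : RVec k, ∀ᵐ z ∂D.P,
    Tendsto (fun q : ℝ × RVec k × RVec d => D.condFst (remr m s t q.2.1 q.1) z q.2.2)
      (limTauThetaV D.supp θ₀ (D.w z)) (𝓝 0)
  rem_lim_sq : ∀ t : RVec k, ∀ᵐ a ∂D.lawW,
    Tendsto (fun q : ℝ × RVec k × RVec d => D.condSq (remr m s t q.2.1 q.1) a q.2.2)
      (limTauThetaV D.supp θ₀ a) (𝓝 0)
  rem_lim_R : ∀ t : RVec k, ∀ᵐ a ∂D.lawW,
    Tendsto (fun q : ℝ × RVec k × RVec d => D.remR (remr m s t) H t q.2.1 q.1 a q.2.2)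
      (limTauThetaV D.supp θ₀ a) (𝓝 0)
  -- moment bounds
  moments : ∃ δ : ℝ, 0 < δ ∧ ∃ b : Z → ℝ, Measurable b ∧
    (∀ᵐ p ∂D.pairLaw, ∀ θ ∈ Metric.ball θ₀ δ, ‖s p.1 p.2 θ‖ ≤ b p.1 * b p.2) ∧
    ∫⁻ z, ENNReal.ofReal (b z ^ 4) ∂D.P < ∞ ∧
    (⨆ a ∈ D.supp, (∫⁻ z, ENNReal.ofReal (b z ^ 4) ∂D.κ a) * ENNReal.ofReal (D.f a)) < ∞ ∧
    ∀ t : RVec k, FiniteMean D.lawW (fun a => ⨆ θ ∈ Metric.ball θ₀ δ, ⨆ v ∈ D.supp,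
      ENNReal.ofReal (matNorm (H a v θ t) * D.f v))
  -- variance ingredients and nonsingularity
  variance : ∃ (G₀ : RVec d → Matrix (Fin k) (Fin k) ℝ) (ξ₀ : Z → RVec k)
    (Ξ₀ : RVec d → Matrix (Fin k) (Fin k) ℝ), VarianceIngredients D s H θ₀ G₀ ξ₀ Ξ₀

/-- With probability one `v ↦ ψ(w, v)` is twice continuously differentiable on `ℝᵈ`, and each of its
partial derivatives of order at most two has a supremum over the support of `w` of finite mean. -/
def SmoothPsi {d k : ℕ} {Z : Type*} [MeasurableSpace Z] (D : Population d Z)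
    (s : Z → Z → RVec k → RVec k) (θ₀ : RVec k) : Prop :=
  (∀ᵐ a ∂D.lawW, ContDiff ℝ 2 (D.ψ s θ₀ a)) ∧
  ∀ n ≤ 2, ∀ i : Fin n → Fin d,
    FiniteMean D.lawW (fun a => ⨆ v ∈ D.supp, ‖partialDeriv i (D.ψ s θ₀ a) v‖ₑ)

end PairwiseDiff

end

/-! Zoom in on `θ₀` at scale `h²`: put `q_h(t) = h⁻⁴ (M(θ₀ + h² t; h) - M(θ₀; h))`. Minimizers
`θ(h)` of `M(·; h)` correspond to minimizers `h⁻² (θ(h) - θ₀)` of `q_h`, so the claim is that the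
latter exist and converge. Each `q_h` is convex, on sets that exhaust `ℝᵏ` as `h ↓ 0`, and it
converges pointwise to `½ t'Γt + β't` with `Γ = E[G₀(w)]` positive definite
(`exists_tendsto_rescaled`). For convex functions in finite dimension, pointwise convergence to a
function with a unique minimizer already forces existence and convergence of minimizers
(`eventually_exists_min_of_convexOn`, `eventually_lt_of_convexOn`). Hence `b₂ = -Γ⁻¹β`.

For the pointwise limit, the definition of `r_t` with `τ = h²` splits `q_h(t)` into `h⁻² E[r_t K_h]`
and `h⁻² E[s K_h]'t`. Conditioning on `w₁, w₂` and substituting `w₂ = a - h u` turns both into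
averages over `a` drawn from the law of `w` and `u` drawn from `K` (`integral_kernel_smul_eq`). In
the first, `E[r_t | w₁, w₂] / h²` equals `½ t'Ht + R_t`, and a dominated limit leaves `½ t'Γt`
(`tendsto_integral_remr`). The second involves `h⁻²` times the average of `ψ(a, a - h u)`. Symmetry
of `K` makes this half the average of the second difference of `ψ(a, ·)`, once `ψ(a, a)` is known to
have mean zero; the first-order term never appears (`tendsto_integral_second_order`). The mean-zero
property is the first-order condition for the minimum of `M₀` at the interior point `θ₀`
(`integral_ψ_diag_eq_zero`).

Two points need care. Identities between conditional expectations hold for almost every `(w₁, w₂)`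
only, which says nothing on the null diagonal, so the expansion of `M₀` is carried over from nearby
off-diagonal values. And `a - h u` may leave the support, where the integrand drops to zero; this is
negligible since almost every point of a closed set is a density point
(`tendsto_integral_kernelLaw`). -/

noncomputable section

namespace PairwiseDiff

/-! ### Minimizers of convex functions that converge pointwise -/

section ConvexArgmin

variable {E : Type*} [NormedAddCommGroup E] [NormedSpace ℝ E] [FiniteDimensional ℝ E]
  {ι : Type*} {l : Filter ι} {C : ι → Set E} {q : ι → E → ℝ} {Q : E → ℝ}

/-- Convex functions that converge pointwise are locally uniformly bounded from above. -/
lemma exists_ball_eventually_le (hconv : ∀ᶠ i in l, ConvexOn ℝ (C i) (q i))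
    (hC : ∀ R, ∀ᶠ i in l, Metric.ball (0 : E) R ⊆ C i)
    (hq : ∀ t, Tendsto (fun i => q i t) l (𝓝 (Q t))) (x : E) :
    ∃ r > 0, ∃ B : ℝ, ∀ᶠ i in l, ∀ y ∈ Metric.ball x r, q i y ≤ B := by
  -- A simplex containing `x` in its interior: a convex function on it is at most its maximum over
  -- the finitely many vertices, where pointwise convergence applies.
  obtain ⟨b, hxb, -⟩ :=
    exists_mem_interior_convexHull_affineBasis (s := Set.univ) (x := x) Filter.univ_mem
  obtain ⟨r, hr, hball⟩ := Metric.mem_nhds_iff.1 (mem_interior_iff_mem_nhds.1 hxb)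
  obtain ⟨R, hR⟩ := ((Set.finite_range b).isBounded).subset_ball (0 : E)
  obtain ⟨B, hB⟩ := ((Set.finite_range b).image Q).bddAbove
  refine ⟨r, hr, B + 1, ?_⟩
  have hfin : ∀ᶠ i in l, ∀ t ∈ Set.range b, q i t ≤ B + 1 := by
    rw [eventually_all_finite (Set.finite_range b)]
    intro t ht
    have : Q t < B + 1 := lt_of_le_of_lt (hB (Set.mem_image_of_mem Q ht)) (lt_add_one B)
    exact ((hq t).eventually (eventually_lt_nhds this)).mono fun i hi => hi.le
  filter_upwards [hconv, hC R, hfin] with i hi hCi hbi y hy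
  have hsub : Set.range b ⊆ C i := hR.trans hCi
  obtain ⟨z, hz, hyz⟩ := hi.exists_ge_of_mem_convexHull hsub (hball hy)
  exact hyz.trans (hbi z hz)

/-- Convex functions that converge pointwise are locally eventually larger than every number below
the limit. -/
lemma exists_nhds_eventually_lt (hconv : ∀ᶠ i in l, ConvexOn ℝ (C i) (q i))
    (hC : ∀ R, ∀ᶠ i in l, Metric.ball (0 : E) R ⊆ C i)
    (hq : ∀ t, Tendsto (fun i => q i t) l (𝓝 (Q t))) {x : E} {c : ℝ} (hc : c < Q x) :
    ∃ U ∈ 𝓝 x, ∀ᶠ i in l, ∀ y ∈ U, c < q i y := by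
  obtain ⟨r, hr, B, hB⟩ := exists_ball_eventually_le hconv hC hq x
  obtain ⟨c', hcc', hc'⟩ := exists_between hc
  -- For `y = x + ε v`, the point `x` is a convex combination of `y` and the opposite point `x - v`,
  -- so `(1 + ε) q(x) ≤ q(y) + ε q(x - v)`. With `q(x) > c'` and `q(x - v) ≤ B` this bounds `q(y)`
  -- below by the expression here, which tends to `c' > c`.
  have hε : ∀ᶠ ε : ℝ in 𝓝[>] 0, c < (1 + ε) * c' - ε * B := by
    have : Tendsto (fun ε : ℝ => (1 + ε) * c' - ε * B) (𝓝[>] 0) (𝓝 ((1 + 0) * c' - 0 * B)) :=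
      (Continuous.tendsto (by fun_prop) 0).mono_left nhdsWithin_le_nhds
    exact this.eventually (eventually_gt_nhds (by simpa using hcc'))
  obtain ⟨ε, hcε, hε0⟩ := (hε.and self_mem_nhdsWithin).exists
  have hε0 : 0 < ε := hε0
  refine ⟨Metric.ball x (ε * r), Metric.ball_mem_nhds _ (by positivity), ?_⟩
  filter_upwards [hconv, hC (‖x‖ + (ε * r + r)), hB, (hq x).eventually (eventually_gt_nhds hc')]
    with i hi hCi hBi hqi y hy
  set v := ε⁻¹ • (y - x) with hv
  have hyv : y = x + ε • v := by rw [hv, smul_inv_smul₀ hε0.ne']; abel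
  have hvr : ‖v‖ < r := by
    rw [hv, norm_smul, norm_inv, Real.norm_of_nonneg hε0.le, inv_mul_lt_iff₀ hε0]
    exact mem_ball_iff_norm.1 hy
  have hz : x - v ∈ Metric.ball x r := by simpa [mem_ball_iff_norm] using hvr
  have hyC : y ∈ C i := hCi (by
    rw [mem_ball_zero_iff]
    have h1 := norm_add_le x (y - x)
    have h2 := mem_ball_iff_norm.1 hy
    rw [add_sub_cancel] at h1
    linarith)
  have hzC : x - v ∈ C i := hCi (by
    rw [mem_ball_zero_iff]
    have h1 := norm_sub_le x v
    have : 0 < ε * r := by positivity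
    linarith)
  have hconvx := hi.2 hyC hzC (show 0 ≤ 1 / (1 + ε) by positivity)
    (show 0 ≤ ε / (1 + ε) by positivity) (by field_simp)
  have hxe : (1 / (1 + ε)) • y + (ε / (1 + ε)) • (x - v) = x := by
    rw [hyv]
    have h1 : (1 / (1 + ε)) + ε / (1 + ε) = 1 := by field_simp
    have h2 : (1 / (1 + ε)) * ε = ε / (1 + ε) := by ring
    calc _ = ((1 / (1 + ε)) + ε / (1 + ε)) • x + ((1 / (1 + ε)) * ε - ε / (1 + ε)) • v := by
          module
      _ = x := by rw [h1, h2]; simp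
  rw [hxe] at hconvx
  have h3 := hBi _ hz
  simp only [smul_eq_mul] at hconvx
  have h4 : (1 + ε) * q i x ≤ q i y + ε * q i (x - v) := by
    have := mul_le_mul_of_nonneg_left hconvx (by positivity : 0 ≤ 1 + ε)
    calc _ ≤ _ := this
      _ = _ := by field_simp
  have h5 : ε * q i (x - v) ≤ ε * B := by gcongr
  have h6 : (1 + ε) * c' ≤ (1 + ε) * q i x := by gcongr
  linarith

/-- Outside a ball around the minimizer of the limit, convex functions that converge pointwise are
eventually larger than at the minimizer of the limit. -/
theorem eventually_lt_of_convexOn (hconv : ∀ᶠ i in l, ConvexOn ℝ (C i) (q i))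
    (hC : ∀ R, ∀ᶠ i in l, Metric.ball (0 : E) R ⊆ C i)
    (hq : ∀ t, Tendsto (fun i => q i t) l (𝓝 (Q t))) {x : E} (hx : ∀ t, t ≠ x → Q x < Q t)
    {ε : ℝ} (hε : 0 < ε) : ∀ᶠ i in l, ∀ t ∈ C i, ε ≤ ‖t - x‖ → q i x < q i t := by
  have hsphere : ∀ᶠ i in l, ∀ t ∈ Metric.sphere x ε, q i x < q i t := by
    refine (isCompact_sphere x ε).induction_on (p := fun S => ∀ᶠ i in l, ∀ t ∈ S, q i x < q i t)
      (by simp) (fun s t hst ht => ht.mono fun i hi y hy => hi y (hst hy))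
      (fun s t hs ht => ?_) (fun t ht => ?_)
    · filter_upwards [hs, ht] with i h1 h2 y hy
      exact hy.elim (h1 y) (h2 y)
    · have htx : t ≠ x := by
        rintro rfl
        simp at ht
        exact hε.ne ht
      obtain ⟨c, hc1, hc2⟩ := exists_between (hx t htx)
      obtain ⟨U, hU, hUi⟩ := exists_nhds_eventually_lt hconv hC hq hc2
      refine ⟨U, mem_nhdsWithin_of_mem_nhds hU, ?_⟩
      filter_upwards [hUi, (hq x).eventually (eventually_lt_nhds hc1)] with i h1 h2 y hy
      exact h2.trans (h1 y hy)
  filter_upwards [hconv, hC (‖x‖ + 1), hsphere] with i hi hCi hsi t ht hεt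
  have hxC : x ∈ C i := hCi (by simp)
  have htn : 0 < ‖t - x‖ := hε.trans_le hεt
  -- The segment from `x` to a far point `t` crosses the sphere of radius `ε`. If `q(t) ≤ q(x)`,
  -- convexity would give a value at most `q(x)` at the crossing.
  set a := ε / ‖t - x‖ with ha
  have ha0 : 0 < a := by positivity
  have ha1 : a ≤ 1 := (div_le_one htn).2 hεt
  have h1 := hi.2 hxC ht (show 0 ≤ 1 - a by linarith) ha0.le (by ring)
  have hs : (1 - a) • x + a • t ∈ Metric.sphere x ε := by
    rw [mem_sphere_iff_norm]
    have : (1 - a) • x + a • t - x = a • (t - x) := by module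
    rw [this, norm_smul, Real.norm_of_nonneg ha0.le, ha, div_mul_cancel₀ _ htn.ne']
  have h2 := hsi _ hs
  simp only [smul_eq_mul] at h1
  by_contra! hcon
  nlinarith

/-- Convex functions that converge pointwise to a function with a unique minimizer eventually have
a minimizer. -/
theorem eventually_exists_min_of_convexOn (hconv : ∀ᶠ i in l, ConvexOn ℝ (C i) (q i))
    (hC : ∀ R, ∀ᶠ i in l, Metric.ball (0 : E) R ⊆ C i)
    (hq : ∀ t, Tendsto (fun i => q i t) l (𝓝 (Q t))) {x : E} (hx : ∀ t, t ≠ x → Q x < Q t) :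
    ∀ᶠ i in l, ∃ t ∈ C i, ∀ t' ∈ C i, q i t ≤ q i t' := by
  filter_upwards [hconv, hC (‖x‖ + 2), eventually_lt_of_convexOn hconv hC hq hx one_pos]
    with i hi hCi hlt
  have hball : Metric.ball x 2 ⊆ C i := fun y hy => hCi (by
    rw [mem_ball_zero_iff]
    have h1 := norm_add_le x (y - x)
    rw [add_sub_cancel] at h1
    have h2 := mem_ball_iff_norm.1 hy
    linarith)
  -- A finite-dimensional convex function is continuous on open subsets of its domain, so a
  -- minimizer exists on a compact ball; beyond it the values exceed the one at `x`.
  have hcont : ContinuousOn (q i) (Metric.closedBall x 1) :=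
    ((hi.subset hball (convex_ball x 2)).continuousOn Metric.isOpen_ball).mono
      (Metric.closedBall_subset_ball (by norm_num))
  obtain ⟨t, ht, hmin⟩ := (isCompact_closedBall x 1).exists_isMinOn
    ⟨x, Metric.mem_closedBall_self zero_le_one⟩ hcont
  refine ⟨t, hball (Metric.closedBall_subset_ball (by norm_num) ht), fun t' ht' => ?_⟩
  by_cases h : t' ∈ Metric.closedBall x 1
  · exact hmin h
  · rw [mem_closedBall_iff_norm, not_le] at h
    exact (hmin (Metric.mem_closedBall_self zero_le_one)).trans (hlt t' ht' h.le).le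

end ConvexArgmin

/-! ### Conditioning on `w₁, w₂` and the change of variables `v = a - h u` -/

/-- The measure with Lebesgue density `K`. -/
def kernelLaw {d : ℕ} (K : RVec d → ℝ) : Measure (RVec d) :=
  volume.withDensity fun u => ENNReal.ofReal (K u)

namespace Population

variable {d k : ℕ} {Z : Type*} [MeasurableSpace Z] (D : Population d Z)
  {E : Type*} [NormedAddCommGroup E] [NormedSpace ℝ E]

instance : IsProbabilityMeasure D.P := D.isProbabilityMeasure

instance : IsMarkovKernel D.κ := D.isMarkovKernel

instance : IsProbabilityMeasure D.lawW :=
  Measure.isProbabilityMeasure_map D.measurable_w.aemeasurable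

instance (a v : RVec d) : IsProbabilityMeasure (D.condPairLaw a v) := by
  unfold condPairLaw; infer_instance

instance : IsProbabilityMeasure D.pairLaw := by
  unfold pairLaw; infer_instance

lemma lintegral_law {φ : RVec d × Z → ℝ≥0∞} (hφ : Measurable φ) :
    ∫⁻ z, φ (D.w z, z) ∂D.P = ∫⁻ a, ∫⁻ z, φ (a, z) ∂D.κ a ∂D.lawW := by
  have h := D.disintegration
  have hm : Measurable fun z => (D.w z, z) := D.measurable_w.prodMk measurable_id
  rw [← lintegral_map hφ hm, h]
  have : IsProbabilityMeasure (D.P.map D.w) := inferInstanceAs (IsProbabilityMeasure D.lawW)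
  exact Measure.lintegral_compProd hφ

/-- By independence the two copies disintegrate separately, which makes `condPair` the conditional
expectation given `(w₁, w₂)`. -/
lemma map_pairLaw :
    D.pairLaw.map (fun p => ((D.w p.1, D.w p.2), p)) = (D.lawW.prod D.lawW) ⊗ₘ (D.κ ∥ₖ D.κ) := by
  have hw := D.measurable_w
  refine Measure.ext_of_lintegral _ fun φ hφ => ?_
  rw [lintegral_map hφ (by fun_prop), Measure.lintegral_compProd hφ, pairLaw,
    lintegral_prod _ (by fun_prop),
    lintegral_prod _ hφ.lintegral_kernel_prod_right'.aemeasurable]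
  have h1 : ∀ x : Z, ∫⁻ y, φ ((D.w x, D.w y), x, y) ∂D.P
      = ∫⁻ v, ∫⁻ y, φ ((D.w x, v), x, y) ∂D.κ v ∂D.lawW := fun x =>
    D.lintegral_law (φ := fun q => φ ((D.w x, q.1), x, q.2)) (by fun_prop)
  simp_rw [h1]
  rw [D.lintegral_law (φ := fun q => ∫⁻ v, ∫⁻ y, φ ((q.1, v), q.2, y) ∂D.κ v ∂D.lawW)
    (by
      have : Measurable fun r : (RVec d × Z) × RVec d =>
          ∫⁻ y, φ ((r.1.1, r.2), r.1.2, y) ∂D.κ r.2 := by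
        refine Measurable.lintegral_kernel_prod_right' (κ := D.κ.comap Prod.snd measurable_snd)
          (f := fun s : ((RVec d × Z) × RVec d) × Z => φ ((s.1.1.1, s.1.2), s.1.1.2, s.2)) ?_
        fun_prop
      exact this.lintegral_prod_right')]
  refine lintegral_congr fun a => ?_
  rw [lintegral_lintegral_swap]
  · refine lintegral_congr fun v => ?_
    rw [Kernel.parallelComp_apply, lintegral_prod _ (by fun_prop)]
  · have : Measurable fun r : Z × RVec d => ∫⁻ y, φ ((a, r.2), r.1, y) ∂D.κ r.2 := by
      refine Measurable.lintegral_kernel_prod_right' (κ := D.κ.comap Prod.snd measurable_snd)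
        (f := fun s : (Z × RVec d) × Z => φ ((a, s.1.2), s.1.1, s.2)) ?_
      fun_prop
    exact this.aemeasurable

/-- The substitution `v = a - h u` has Jacobian `hᵈ`, which cancels the normalization of `K_h`. The
density of `w` becomes a weight and `K` the law of `u`. -/
lemma lintegral_kernel_scale {K : RVec d → ℝ} (hK : Measurable K) {h : ℝ} (hh : 0 < h)
    (a : RVec d) {φ : RVec d → ℝ≥0∞} (hφ : Measurable φ) :
    ∫⁻ v, ENNReal.ofReal ((h ^ d)⁻¹ * K (h⁻¹ • (a - v))) * φ v ∂D.lawW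
      = ∫⁻ u, ENNReal.ofReal (D.f (a - h • u)) * φ (a - h • u) ∂kernelLaw K := by
  have hf := D.measurable_f
  rw [lawW, D.law_w, kernelLaw, lintegral_withDensity_eq_lintegral_mul _ (by fun_prop) (by fun_prop),
    lintegral_withDensity_eq_lintegral_mul _ (by fun_prop) (by fun_prop)]
  simp only [Pi.mul_apply]
  set F : RVec d → ℝ≥0∞ := fun v =>
    ENNReal.ofReal (D.f v) * (ENNReal.ofReal ((h ^ d)⁻¹ * K (h⁻¹ • (a - v))) * φ v) with hF
  have hFm : Measurable F := by fun_prop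
  have hsc := Measure.map_addHaar_smul (volume : Measure (RVec d)) hh.ne'
  rw [finrank_euclideanSpace_fin] at hsc
  have h1 : ∫⁻ u, F (a - h • u) = ENNReal.ofReal |(h ^ d)⁻¹| * ∫⁻ v, F v := by
    have : ∫⁻ u, F (a - h • u) = ∫⁻ x, F (a - x) ∂(Measure.map (fun x => h • x) volume) := by
      rw [lintegral_map (by fun_prop) (by fun_prop)]
    rw [this, hsc, lintegral_smul_measure, lintegral_sub_left_eq_self F a, smul_eq_mul]
  have hpos : 0 < (h ^ d)⁻¹ := by positivity
  have h2 : ∀ u, F (a - h • u) = ENNReal.ofReal |(h ^ d)⁻¹| *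
      (ENNReal.ofReal (K u) * (ENNReal.ofReal (D.f (a - h • u)) * φ (a - h • u))) := by
    intro u
    simp only [hF, sub_sub_cancel, inv_smul_smul₀ hh.ne', abs_of_pos hpos,
      ENNReal.ofReal_mul hpos.le]
    ring
  simp_rw [h2] at h1
  rw [lintegral_const_mul _ (by fun_prop)] at h1
  refine ((ENNReal.mul_right_inj ?_ ENNReal.ofReal_ne_top).1 h1).symm
  simpa using (pow_pos (abs_pos.2 hh.ne') d)

/-- The law of `(w₁, w₂)` reweighted by `K_h(w₁ - w₂)` is the image, under `(a, u) ↦ (a, a - h u)`,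
of a measure with density with respect to the product of the law of `w` and `K`. -/
lemma withDensity_kernel_eq_map {K : RVec d → ℝ} (hK : Measurable K) [SFinite (kernelLaw K)] {h : ℝ}
    (hh : 0 < h) :
    (D.lawW.prod D.lawW).withDensity
        (fun q => ENNReal.ofReal ((h ^ d)⁻¹ * K (h⁻¹ • (q.1 - q.2))))
      = ((D.lawW.prod (kernelLaw K)).withDensity
          (fun q => ENNReal.ofReal (D.f (q.1 - h • q.2)))).map (fun q => (q.1, q.1 - h • q.2)) := by
  have hf := D.measurable_f
  refine Measure.ext_of_lintegral _ fun φ hφ => ?_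
  rw [lintegral_map hφ (by fun_prop),
    lintegral_withDensity_eq_lintegral_mul _ (by fun_prop) (by fun_prop),
    lintegral_withDensity_eq_lintegral_mul _ (by fun_prop) (by fun_prop),
    lintegral_prod _ (by fun_prop), lintegral_prod _ (by fun_prop)]
  exact lintegral_congr fun a => D.lintegral_kernel_scale hK hh a (φ := fun v => φ (a, v))
    (by fun_prop)

lemma stronglyMeasurable_condPair {g : Z → Z → E}
    (hg : StronglyMeasurable fun p : Z × Z => g p.1 p.2) :
    StronglyMeasurable fun q : RVec d × RVec d => D.condPair g q.1 q.2 := by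
  have := StronglyMeasurable.integral_kernel (κ := D.κ ∥ₖ D.κ) hg
  simp only [Kernel.parallelComp_apply] at this
  exact this

/-- The Bochner integral of a non-integrable function is zero, so `condPair` is not additive
unconditionally; this is what licenses `ae_condPair_sub`. -/
lemma ae_integrable_condPairLaw {F : Type*} [NormedAddCommGroup F] {g : Z → Z → F}
    (hg : StronglyMeasurable fun p : Z × Z => g p.1 p.2)
    (hgi : Integrable (fun p : Z × Z => g p.1 p.2) D.pairLaw) :
    ∀ᵐ q ∂D.lawW.prod D.lawW, Integrable (fun p : Z × Z => g p.1 p.2) (D.condPairLaw q.1 q.2) := by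
  have hw := D.measurable_w
  have hg' : StronglyMeasurable fun x : (RVec d × RVec d) × (Z × Z) => g x.2.1 x.2.2 :=
    hg.comp_measurable measurable_snd
  have h1 : Integrable (fun x : (RVec d × RVec d) × (Z × Z) => g x.2.1 x.2.2)
      ((D.lawW.prod D.lawW) ⊗ₘ (D.κ ∥ₖ D.κ)) := by
    rw [← D.map_pairLaw]
    exact (integrable_map_measure hg'.aestronglyMeasurable (by fun_prop)).2 hgi
  have h2 := ((Measure.integrable_compProd_iff hg'.aestronglyMeasurable).1 h1).1
  simp only [Kernel.parallelComp_apply] at h2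
  exact h2

/-- The tower property: a weight depending on `(w₁, w₂)` alone leaves the conditional expectation,
and its boundedness preserves integrability. -/
lemma integral_kernel_smul {g : Z → Z → E} (hg : StronglyMeasurable fun p : Z × Z => g p.1 p.2)
    (hgi : Integrable (fun p : Z × Z => g p.1 p.2) D.pairLaw) {c : RVec d × RVec d → ℝ}
    (hc : Measurable c) {B : ℝ} (hB : ∀ q, ‖c q‖ ≤ B) :
    Integrable (fun p => c (D.w p.1, D.w p.2) • g p.1 p.2) D.pairLaw ∧
    Integrable (fun q => c q • D.condPair g q.1 q.2) (D.lawW.prod D.lawW) ∧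
    ∫ p, c (D.w p.1, D.w p.2) • g p.1 p.2 ∂D.pairLaw
      = ∫ q, c q • D.condPair g q.1 q.2 ∂(D.lawW.prod D.lawW) := by
  have hw := D.measurable_w
  have hm : StronglyMeasurable fun x : (RVec d × RVec d) × (Z × Z) => c x.1 • g x.2.1 x.2.2 :=
    (hc.comp measurable_fst).stronglyMeasurable.smul (hg.comp_measurable measurable_snd)
  have h0 : Integrable (fun p => c (D.w p.1, D.w p.2) • g p.1 p.2) D.pairLaw :=
    hgi.bdd_smul B (hc.comp (by fun_prop)).aestronglyMeasurable (Eventually.of_forall fun p => hB _)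
  have h1 : Integrable (fun x : (RVec d × RVec d) × (Z × Z) => c x.1 • g x.2.1 x.2.2)
      ((D.lawW.prod D.lawW) ⊗ₘ (D.κ ∥ₖ D.κ)) := by
    rw [← D.map_pairLaw]
    exact (integrable_map_measure hm.aestronglyMeasurable (by fun_prop)).2 h0
  have h2 : ∀ q, ∫ p, c q • g p.1 p.2 ∂(D.κ ∥ₖ D.κ) q = c q • D.condPair g q.1 q.2 := fun q => by
    rw [integral_smul, Kernel.parallelComp_apply]; rfl
  refine ⟨h0, ?_, ?_⟩
  · have := Integrable.integral_compProd h1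
    simp only [Kernel.prodMkLeft_apply, Kernel.const_apply, h2] at this
    exact this
  · have h3 := Measure.integral_compProd h1
    simp only [h2] at h3
    rw [← h3, ← D.map_pairLaw, integral_map (by fun_prop) hm.aestronglyMeasurable]

/-- `E[g(z₁, z₂) K_h(w₁ - w₂)] = E ∫ E[g(z₁, z₂) | w₁, w₂ = w₁ - h u] f(w₁ - h u) K(u) du`. -/
theorem integral_kernel_smul_eq {g : Z → Z → E}
    (hg : StronglyMeasurable fun p : Z × Z => g p.1 p.2)
    (hgi : Integrable (fun p : Z × Z => g p.1 p.2) D.pairLaw) {K : RVec d → ℝ}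
    (hK : Measurable K) (hK0 : ∀ u, 0 ≤ K u) (hKb : ∃ C, ∀ u, K u ≤ C) [SFinite (kernelLaw K)]
    {h : ℝ} (hh : 0 < h) :
    Integrable (fun p => ((h ^ d)⁻¹ * K (h⁻¹ • (D.w p.1 - D.w p.2))) • g p.1 p.2) D.pairLaw ∧
    Integrable (fun q : RVec d × RVec d => D.f (q.1 - h • q.2) • D.condPair g q.1 (q.1 - h • q.2))
      (D.lawW.prod (kernelLaw K)) ∧
    ∫ p, ((h ^ d)⁻¹ * K (h⁻¹ • (D.w p.1 - D.w p.2))) • g p.1 p.2 ∂D.pairLaw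
      = ∫ q, D.f (q.1 - h • q.2) • D.condPair g q.1 (q.1 - h • q.2)
        ∂(D.lawW.prod (kernelLaw K)) := by
  have hf := D.measurable_f
  obtain ⟨C, hC⟩ := hKb
  have hpos : 0 < (h ^ d)⁻¹ := by positivity
  have hc0 : ∀ q : RVec d × RVec d, 0 ≤ (h ^ d)⁻¹ * K (h⁻¹ • (q.1 - q.2)) := fun q =>
    mul_nonneg hpos.le (hK0 _)
  obtain ⟨h1, h2, h3⟩ := D.integral_kernel_smul hg hgi
    (c := fun q => (h ^ d)⁻¹ * K (h⁻¹ • (q.1 - q.2))) (by fun_prop) (B := (h ^ d)⁻¹ * C)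
    (fun q => by
      rw [Real.norm_of_nonneg (hc0 q)]
      gcongr
      exact hC _)
  have hcm := (D.stronglyMeasurable_condPair hg)
  have hS : Measurable fun q : RVec d × RVec d => (q.1, q.1 - h • q.2) := by fun_prop
  have h4 : Integrable (fun q : RVec d × RVec d => D.condPair g q.1 q.2)
      ((D.lawW.prod D.lawW).withDensity
        (fun q => ENNReal.ofReal ((h ^ d)⁻¹ * K (h⁻¹ • (q.1 - q.2))))) := by
    rw [integrable_withDensity_iff_integrable_smul' (by fun_prop) (by simp)]
    simpa only [ENNReal.toReal_ofReal (hc0 _)] using h2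
  refine ⟨h1, ?_, ?_⟩
  · rw [D.withDensity_kernel_eq_map hK hh, integrable_map_measure hcm.aestronglyMeasurable
      hS.aemeasurable, integrable_withDensity_iff_integrable_smul' (by fun_prop) (by simp)] at h4
    simpa only [ENNReal.toReal_ofReal (D.f_nonneg _), Function.comp_def] using h4
  · rw [h3]
    have h5 : ∫ q, ((h ^ d)⁻¹ * K (h⁻¹ • (q.1 - q.2))) • D.condPair g q.1 q.2
        ∂(D.lawW.prod D.lawW) = ∫ q, D.condPair g q.1 q.2 ∂((D.lawW.prod D.lawW).withDensity
        (fun q => ENNReal.ofReal ((h ^ d)⁻¹ * K (h⁻¹ • (q.1 - q.2))))) := by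
      rw [integral_withDensity_eq_integral_toReal_smul (by fun_prop) (by simp)]
      simp only [ENNReal.toReal_ofReal (hc0 _)]
    rw [h5, D.withDensity_kernel_eq_map hK hh, integral_map hS.aemeasurable
      hcm.aestronglyMeasurable, integral_withDensity_eq_integral_toReal_smul (by fun_prop) (by simp)]
    simp only [ENNReal.toReal_ofReal (D.f_nonneg _)]

end Population

/-! ### Dominated limits of averages over `(a, a - h u)` -/

section KernelLaw

variable {d : ℕ} {K : RVec d → ℝ}

lemma kernelLaw_le {C : ℝ} (hC : ∀ u, K u ≤ C) :
    kernelLaw K ≤ ENNReal.ofReal C • volume := by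
  rw [kernelLaw, ← withDensity_const]
  exact withDensity_mono (Eventually.of_forall fun u => ENNReal.ofReal_le_ofReal (hC u))

lemma measurePreserving_neg_kernelLaw (hK : Measurable K) (hsymm : ∀ u, K (-u) = K u) :
    MeasurePreserving (fun u => -u) (kernelLaw K) (kernelLaw K) := by
  refine ⟨measurable_neg, Measure.ext_of_lintegral _ fun φ hφ => ?_⟩
  rw [lintegral_map hφ measurable_neg, kernelLaw,
    lintegral_withDensity_eq_lintegral_mul _ (by fun_prop) (by fun_prop),
    lintegral_withDensity_eq_lintegral_mul _ (by fun_prop) (by fun_prop),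
    ← lintegral_neg_eq_self (μ := volume)
      ((fun u => ENNReal.ofReal (K u)) * φ)]
  refine lintegral_congr fun u => ?_
  simp [hsymm u]

/-- Hence `a - h u ≠ a` almost surely, so limits that exclude the point `a` suffice later. -/
lemma kernelLaw_singleton_zero (hd : 0 < d) : kernelLaw K {(0 : RVec d)} = 0 := by
  have : Nonempty (Fin d) := ⟨⟨0, hd⟩⟩
  exact withDensity_absolutelyContinuous _ _ (measure_singleton _)

/-- Up to a scale factor, the part of the ball of radius `h R` around `a` that lies in `T` is the set
of `u` in the ball of radius `R` such that `a - h u` lies in `T`. -/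
lemma volume_preimage_scale {T : Set (RVec d)} (hT : MeasurableSet T) {h R : ℝ} (hh : 0 < h)
    (a : RVec d) :
    volume {u : RVec d | u ∈ Metric.closedBall 0 R ∧ a - h • u ∈ T}
      = ENNReal.ofReal |(h ^ d)⁻¹| * volume (T ∩ Metric.closedBall a (h * R)) := by
  have h1 : {u : RVec d | u ∈ Metric.closedBall 0 R ∧ a - h • u ∈ T}
      = (fun u => h • u) ⁻¹' ((fun v => a - v) ⁻¹' (T ∩ Metric.closedBall a (h * R))) := by
    ext u
    simp only [Set.mem_ofPred_eq, Set.mem_preimage, Set.mem_inter_iff,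
      mem_closedBall_iff_norm, sub_zero, sub_sub_cancel_left, norm_neg, norm_smul, Real.norm_of_nonneg hh.le,
      mul_le_mul_iff_right₀ hh]
    tauto
  rw [h1, Measure.addHaar_preimage_smul _ hh.ne', finrank_euclideanSpace_fin,
    (volume.measurePreserving_sub_left a).measure_preimage
      (hT.inter Metric.isClosed_closedBall.measurableSet).nullMeasurableSet]

/-- Almost every point `a` of a closed set `S` is a density point, in the sense that `a - h u` is in
`S` with high probability for small `h`. -/
theorem ae_tendsto_kernelLaw_compl {C : ℝ} (hC : ∀ u, K u ≤ C) [IsFiniteMeasure (kernelLaw K)]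
    {S : Set (RVec d)} (hS : IsClosed S) :
    ∀ᵐ a, a ∈ S →
      Tendsto (fun h : ℝ => kernelLaw K {u | a - h • u ∉ S}) (𝓝[>] 0) (𝓝 0) := by
  filter_upwards [Besicovitch.ae_tendsto_measure_inter_div_of_measurableSet volume
    hS.measurableSet.compl] with a ha haS
  rw [Set.indicator_of_notMem (by simpa using haS)] at ha
  rw [ENNReal.tendsto_nhds_zero]
  intro ε hε
  -- `K` may have unbounded support. A large ball carries all but `ε / 2` of its mass, and inside it
  -- `K ≤ C` reduces the claim to the Lebesgue density of the complement of `S` near `a`.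
  have htail := tendsto_measure_compl_closedBall_of_isTightMeasureSet
    (isTightMeasureSet_singleton (μ := kernelLaw K)) (0 : RVec d)
  simp only [Set.mem_singleton_iff, iSup_iSup_eq_left] at htail
  obtain ⟨R, hR, hR0⟩ := (((ENNReal.tendsto_nhds_zero.1 htail) (ε / 2)
    (ENNReal.half_pos hε.ne')).and (eventually_gt_atTop 0)).exists
  have hscale : Tendsto (fun h : ℝ => h * R) (𝓝[>] 0) (𝓝[>] 0) := by
    refine tendsto_nhdsWithin_iff.2 ⟨?_, ?_⟩
    · have : Tendsto (fun h : ℝ => h * R) (𝓝 0) (𝓝 (0 * R)) := by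
        exact (continuous_id.mul continuous_const).tendsto 0
      rw [zero_mul] at this
      exact this.mono_left nhdsWithin_le_nhds
    · filter_upwards [self_mem_nhdsWithin] with h hh
      exact mul_pos hh hR0
  have h1 : Tendsto (fun h : ℝ => ENNReal.ofReal C * (volume (Sᶜ ∩ Metric.closedBall a (h * R)) /
      volume (Metric.closedBall a (h * R)) * volume (Metric.closedBall (0 : RVec d) R)))
      (𝓝[>] 0) (𝓝 0) := by
    have hb : volume (Metric.closedBall (0 : RVec d) R) ≠ ∞ := measure_closedBall_lt_top.ne
    have := ENNReal.Tendsto.const_mul (a := ENNReal.ofReal C) (ENNReal.Tendsto.mul_const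
      (b := volume (Metric.closedBall (0 : RVec d) R)) (ha.comp hscale) (Or.inr hb))
      (Or.inr ENNReal.ofReal_ne_top)
    simpa using this
  filter_upwards [(ENNReal.tendsto_nhds_zero.1 h1) (ε / 2) (ENNReal.half_pos hε.ne'),
    self_mem_nhdsWithin] with h hhε hh
  have hh : 0 < h := hh
  have hsub : {u | a - h • u ∉ S} ⊆ (Metric.closedBall (0 : RVec d) R)ᶜ ∪
      {u : RVec d | u ∈ Metric.closedBall 0 R ∧ a - h • u ∈ Sᶜ} := by
    intro u hu
    by_cases hb : u ∈ Metric.closedBall (0 : RVec d) R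
    · exact Or.inr ⟨hb, hu⟩
    · exact Or.inl hb
  have hball := volume_preimage_scale (T := Set.univ) MeasurableSet.univ (R := R) hh a
  simp only [Set.mem_univ, and_true, Set.univ_inter] at hball
  have hball' : volume (Metric.closedBall (0 : RVec d) R)
      = ENNReal.ofReal |(h ^ d)⁻¹| * volume (Metric.closedBall a (h * R)) := hball
  have hcb0 : volume (Metric.closedBall a (h * R)) ≠ 0 :=
    (Metric.measure_closedBall_pos volume a (by positivity)).ne'
  have hcbt : volume (Metric.closedBall a (h * R)) ≠ ∞ := measure_closedBall_lt_top.ne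
  have h2 : kernelLaw K {u : RVec d | u ∈ Metric.closedBall 0 R ∧ a - h • u ∈ Sᶜ} ≤ ε / 2 := by
    refine le_trans ((kernelLaw_le hC) _) (le_trans (le_of_eq ?_) hhε)
    rw [Measure.smul_apply, smul_eq_mul, volume_preimage_scale hS.measurableSet.compl hh, hball']
    congr 1
    rw [mul_left_comm, ENNReal.div_mul_cancel hcb0 hcbt]
  calc kernelLaw K {u | a - h • u ∉ S} ≤ _ := measure_mono hsub
    _ ≤ _ := measure_union_le _ _
    _ ≤ ε / 2 + ε / 2 := add_le_add hR h2
    _ = ε := ENNReal.add_halves ε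

/-- A dominated limit of integrals of `φ h a (a - h u)`, for functions `φ h a` that vanish outside the
closed set `S`. -/
theorem tendsto_integral_kernelLaw [IsProbabilityMeasure (kernelLaw K)] {W : Measure (RVec d)}
    [IsProbabilityMeasure W] (hd : 0 < d) {C : ℝ} (hC : ∀ u, K u ≤ C) (hW : W ≪ volume)
    {S : Set (RVec d)} (hS : IsClosed S) (hWS : ∀ᵐ a ∂W, a ∈ S)
    {φ : ℝ → RVec d → RVec d → ℝ} {G g : RVec d → ℝ}
    (hφm : ∀ᶠ h in 𝓝[>] (0 : ℝ), AEStronglyMeasurable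
      (fun q : RVec d × RVec d => φ h q.1 (q.1 - h • q.2)) (W.prod (kernelLaw K)))
    (hφ0 : ∀ h a v, v ∉ S → φ h a v = 0)
    (hG : Integrable G W) (hg : Integrable g W)
    (hφG : ∀ᶠ h in 𝓝[>] (0 : ℝ), ∀ᵐ a ∂W, ∀ v ∈ S, |φ h a v| ≤ G a)
    (hφg : ∀ᵐ a ∂W, Tendsto (fun p : ℝ × RVec d => φ p.1 a p.2)
      (𝓝[>] 0 ×ˢ 𝓝[S \ {a}] a) (𝓝 (g a))) :
    Tendsto (fun h : ℝ => ∫ q, φ h q.1 (q.1 - h • q.2) ∂W.prod (kernelLaw K)) (𝓝[>] 0)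
      (𝓝 (∫ a, g a ∂W)) := by
  set ν := kernelLaw K with hν
  -- Off `S` the integrand is zero and need not be near `g`. Adding `g` on `T h` makes it converge
  -- almost everywhere (`hB`), and the integral of this patch vanishes because almost every `a` is a
  -- density point (`hA`).
  set T : ℝ → Set (RVec d × RVec d) := fun h => {q | q.1 - h • q.2 ∉ S} with hT
  have hTm : ∀ h, MeasurableSet (T h) := fun h =>
    (hS.measurableSet.preimage (f := fun q : RVec d × RVec d => q.1 - h • q.2) (by fun_prop)).compl
  have hg1 : Integrable (fun q : RVec d × RVec d => g q.1) (W.prod ν) := hg.comp_fst ν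
  have hG1 : Integrable (fun q : RVec d × RVec d => G q.1) (W.prod ν) := hG.comp_fst ν
  have hAi : ∀ h, Integrable ((T h).indicator fun q => g q.1) (W.prod ν) := fun h =>
    hg1.indicator (hTm h)
  have hA : Tendsto (fun h : ℝ => ∫ q, (T h).indicator (fun q => g q.1) q ∂W.prod ν) (𝓝[>] 0)
      (𝓝 0) := by
    have h1 : ∀ h : ℝ, ∫ q, (T h).indicator (fun q => g q.1) q ∂W.prod ν
        = ∫ a, ν.real {u | a - h • u ∉ S} * g a ∂W := by
      intro h
      rw [integral_prod _ (hAi h)]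
      congr 1
      ext a
      have : (fun u => (T h).indicator (fun q => g q.1) (a, u))
          = Set.indicator {u | a - h • u ∉ S} (fun _ => g a) := by
        ext u
        rfl
      rw [this, integral_indicator_const, smul_eq_mul]
      exact (hS.measurableSet.preimage (f := fun u : RVec d => a - h • u) (by fun_prop)).compl
    simp_rw [h1]
    rw [← integral_zero (RVec d) ℝ (μ := W)]
    refine tendsto_integral_filter_of_dominated_convergence (fun a => |g a|)
      (Eventually.of_forall fun h => ?_) (Eventually.of_forall fun h => ae_of_all _ fun a => ?_)
      hg.abs ?_
    · refine AEStronglyMeasurable.mul ?_ hg.aestronglyMeasurable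
      exact (measurable_measure_prodMk_left (hTm h)).ennreal_toReal.aestronglyMeasurable
    · rw [norm_mul, Real.norm_of_nonneg measureReal_nonneg, Real.norm_eq_abs]
      exact mul_le_of_le_one_left (abs_nonneg _) measureReal_le_one
    · filter_upwards [hW.ae_le (ae_tendsto_kernelLaw_compl hC hS), hWS] with a ha haS
      have h2 := (ENNReal.tendsto_toReal ENNReal.zero_ne_top).comp (ha haS)
      simpa [Measure.real] using h2.mul_const (g a)
  have hB : Tendsto (fun h : ℝ => ∫ q, (φ h q.1 (q.1 - h • q.2)
      + (T h).indicator (fun q => g q.1) q) ∂W.prod ν) (𝓝[>] 0) (𝓝 (∫ q, g q.1 ∂W.prod ν)) := by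
    refine tendsto_integral_filter_of_dominated_convergence (fun q => |G q.1| + |g q.1|) ?_ ?_
      (hG1.abs.add hg1.abs) ?_
    · filter_upwards [hφm] with h hh
      exact hh.add (hAi h).aestronglyMeasurable
    · filter_upwards [hφG] with h hh
      filter_upwards [Measure.quasiMeasurePreserving_fst.ae hh] with q hq
      by_cases hqS : q.1 - h • q.2 ∈ S
      · rw [Set.indicator_of_notMem (by simpa [hT] using hqS), add_zero, Real.norm_eq_abs]
        have := (hq _ hqS).trans (le_abs_self _)
        linarith [abs_nonneg (g q.1)]
      · rw [Set.indicator_of_mem (by simpa [hT] using hqS), hφ0 _ _ _ hqS, zero_add,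
          Real.norm_eq_abs]
        linarith [abs_nonneg (G q.1)]
    · have h0 : ∀ᵐ u ∂ν, u ≠ 0 := by
        rw [ae_iff]
        simpa using kernelLaw_singleton_zero (K := K) hd
      filter_upwards [Measure.quasiMeasurePreserving_fst.ae hφg,
        Measure.quasiMeasurePreserving_snd.ae h0] with q hq hq0
      have hv : Tendsto (fun h : ℝ => q.1 - h • q.2) (𝓝[>] 0) (𝓝 q.1) := by
        have : Tendsto (fun h : ℝ => q.1 - h • q.2) (𝓝 0) (𝓝 (q.1 - (0 : ℝ) • q.2)) :=
          Continuous.tendsto (by fun_prop) 0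
        rw [zero_smul, sub_zero] at this
        exact this.mono_left nhdsWithin_le_nhds
      rw [Metric.tendsto_nhds] at hq ⊢
      intro ε hε
      obtain ⟨pa, hpa, pb, hpb, hab⟩ := eventually_prod_iff.1 (hq ε hε)
      have hpb' := hv.eventually (eventually_nhdsWithin_iff.1 hpb)
      filter_upwards [hpa, hpb', self_mem_nhdsWithin] with h h1 h2 h3
      have h3 : 0 < h := h3
      by_cases hqS : q.1 - h • q.2 ∈ S
      · rw [Set.indicator_of_notMem (by simpa [hT] using hqS), add_zero]
        refine hab h1 (h2 ⟨hqS, ?_⟩)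
        simpa [sub_eq_self] using ⟨h3.ne', hq0⟩
      · rw [Set.indicator_of_mem (by simpa [hT] using hqS), hφ0 _ _ _ hqS, zero_add, dist_self]
        exact hε
  have h3 : ∫ q, g q.1 ∂W.prod ν = ∫ a, g a ∂W := by
    rw [integral_fun_fst]; simp
  rw [h3] at hB
  have h4 := hB.sub hA
  rw [sub_zero] at h4
  refine h4.congr' ?_
  filter_upwards [hφm, hφG] with h hm hh
  rw [← integral_sub _ (hAi h)]
  · simp
  · refine Integrable.add ?_ (hAi h)
    refine Integrable.mono' hG1.abs hm ?_
    filter_upwards [Measure.quasiMeasurePreserving_fst.ae hh] with q hq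
    by_cases hqS : q.1 - h • q.2 ∈ S
    · exact (hq _ hqS).trans (le_abs_self _)
    · rw [hφ0 _ _ _ hqS]; simp

end KernelLaw

/-! ### Second differences -/

section SecondDifference

variable {V F : Type*} [NormedAddCommGroup V] [NormedSpace ℝ V] [NormedAddCommGroup F]
  [NormedSpace ℝ F] {g : V → F}

lemma hasDerivAt_comp_line (hg : Differentiable ℝ g) (a u : V) (x : ℝ) :
    HasDerivAt (fun x : ℝ => g (a + x • u)) (fderiv ℝ g (a + x • u) u) x := by
  have h1 : HasDerivAt (fun x : ℝ => a + x • u) u x := by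
    simpa using ((hasDerivAt_id x).smul_const u).const_add a
  exact (hg (a + x • u)).hasFDerivAt.comp_hasDerivAt x h1

lemma hasDerivAt_fderiv_comp_line (hg : ContDiff ℝ 2 g) (a u : V) (x : ℝ) :
    HasDerivAt (fun x : ℝ => fderiv ℝ g (a + x • u) u)
      (iteratedFDeriv ℝ 2 g (a + x • u) fun _ => u) x := by
  have hd : Differentiable ℝ (fderiv ℝ g) :=
    (hg.fderiv_right (m := 1) (by norm_num)).differentiable one_ne_zero
  rw [iteratedFDeriv_two_apply]
  exact (ContinuousLinearMap.apply ℝ F u).hasFDerivAt.comp_hasDerivAt x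
    (hasDerivAt_comp_line hd a u x)

lemma hasDerivAt_symm_sum (hg : ContDiff ℝ 2 g) (a u : V) (x : ℝ) :
    HasDerivAt (fun x : ℝ => g (a + x • u) + g (a - x • u))
      (fderiv ℝ g (a + x • u) u - fderiv ℝ g (a + (-x) • u) u) x := by
  have hd := hg.differentiable two_ne_zero
  have h1 := (hasDerivAt_comp_line hd a u (-x)).scomp x (hasDerivAt_neg x)
  have h2 := (hasDerivAt_comp_line hd a u x).add h1
  refine (h2.congr_deriv ?_).congr_of_eventuallyEq (Eventually.of_forall fun y => ?_)
  · simp [sub_eq_add_neg]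
  · simp [sub_eq_add_neg]

/-- The mean value inequality is applied twice: to the derivative along the line on `[-x, x]`, then
to the symmetric sum on `[0, h]`. The bound is global in `v`, as required for domination; the factor
2 is not sharp. -/
lemma norm_second_difference_le (hg : ContDiff ℝ 2 g) (a u : V) {B : ℝ}
    (hB : ∀ v, ‖iteratedFDeriv ℝ 2 g v fun _ => u‖ ≤ B) {h : ℝ} (hh : 0 < h) :
    ‖g (a + h • u) + g (a - h • u) - (2 : ℝ) • g a‖ ≤ 2 * B * h ^ 2 := by
  have hB0 : 0 ≤ B := (norm_nonneg _).trans (hB a)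
  have h1 : ∀ x ∈ Set.Icc 0 h,
      ‖fderiv ℝ g (a + x • u) u - fderiv ℝ g (a + (-x) • u) u‖ ≤ 2 * B * h := by
    intro x hx
    have := Convex.norm_image_sub_le_of_norm_hasDerivWithin_le (s := Set.univ)
      (f := fun x : ℝ => fderiv ℝ g (a + x • u) u) (x := -x) (y := x)
      (fun y _ => (hasDerivAt_fderiv_comp_line hg a u y).hasDerivWithinAt) (fun y _ => hB _)
      convex_univ trivial trivial
    refine this.trans ?_
    rw [sub_neg_eq_add, Real.norm_of_nonneg (by linarith [hx.1])]
    nlinarith [hx.1, hx.2]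
  have h2 := Convex.norm_image_sub_le_of_norm_hasDerivWithin_le (s := Set.Icc 0 h)
    (f := fun x : ℝ => g (a + x • u) + g (a - x • u)) (x := 0) (y := h)
    (fun y _ => (hasDerivAt_symm_sum hg a u y).hasDerivWithinAt) h1 (convex_Icc 0 h)
    ⟨le_rfl, hh.le⟩ ⟨hh.le, le_rfl⟩
  simp only [zero_smul, add_zero, sub_zero, Real.norm_of_nonneg hh.le, ← two_smul ℝ (g a)] at h2
  linarith [h2, sq h]

lemma tendsto_second_difference (hg : ContDiff ℝ 2 g) (a u : V) :
    Tendsto (fun h : ℝ => (h ^ 2)⁻¹ • (g (a + h • u) + g (a - h • u) - (2 : ℝ) • g a)) (𝓝[>] 0)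
      (𝓝 (iteratedFDeriv ℝ 2 g a fun _ => u)) := by
  set B := iteratedFDeriv ℝ 2 g a fun _ => u with hBdef
  set p : ℝ → F := fun x => fderiv ℝ g (a + x • u) u with hp
  have hp0 : HasDerivAt p B 0 := by
    have := hasDerivAt_fderiv_comp_line hg a u 0
    rwa [zero_smul, add_zero] at this
  rw [Metric.tendsto_nhds]
  intro ε hε
  -- Two remainders, at `x` and `-x`, add up to `ε / 2`, which leaves room for the strict
  -- inequality.
  have h1 := (hasDerivAt_iff_isLittleO.1 hp0).bound (by positivity : 0 < ε / 4)
  obtain ⟨δ, hδ, hδp⟩ := Metric.eventually_nhds_iff.1 h1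
  filter_upwards [Ioo_mem_nhdsGT hδ] with h hh
  have hh0 : 0 < h := hh.1
  have h2 : ∀ x ∈ Set.Icc 0 h, ‖p x - p (-x) - (2 * x) • B‖ ≤ ε / 2 * h := by
    intro x hx
    have e1 := @hδp x (by simpa [abs_of_nonneg hx.1] using hx.2.trans_lt hh.2)
    have e2 := @hδp (-x) (by simpa [abs_of_nonneg hx.1] using hx.2.trans_lt hh.2)
    simp only [sub_zero, norm_neg, Real.norm_of_nonneg hx.1] at e1 e2
    have e3 : p x - p (-x) - (2 * x) • B = (p x - p 0 - x • B) - (p (-x) - p 0 - (-x) • B) := by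
      module
    rw [e3]
    refine (norm_sub_le _ _).trans ?_
    nlinarith [hx.2]
  have h3 := Convex.norm_image_sub_le_of_norm_hasDerivWithin_le (s := Set.Icc 0 h)
    (f := fun x : ℝ => g (a + x • u) + g (a - x • u) - x ^ 2 • B) (x := 0) (y := h)
    (f' := fun x => p x - p (-x) - (2 * x) • B)
    (fun y _ => ((hasDerivAt_symm_sum hg a u y).sub
      (by simpa using (hasDerivAt_pow 2 y).smul_const B)).hasDerivWithinAt) h2 (convex_Icc 0 h)
    ⟨le_rfl, hh0.le⟩ ⟨hh0.le, le_rfl⟩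
  simp only [zero_smul, add_zero, sub_zero, Real.norm_of_nonneg hh0.le, ← two_smul ℝ (g a),
    ne_eq, OfNat.ofNat_ne_zero, not_false_eq_true, zero_pow] at h3
  have hh2 : 0 < h ^ 2 := by positivity
  have h4 : (h ^ 2)⁻¹ • (g (a + h • u) + g (a - h • u) - (2 : ℝ) • g a) - B
      = (h ^ 2)⁻¹ • (g (a + h • u) + g (a - h • u) - h ^ 2 • B - (2 : ℝ) • g a) := by
    rw [sub_right_comm _ (h ^ 2 • B), smul_sub _ _ (h ^ 2 • B), inv_smul_smul₀ hh2.ne']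
  rw [dist_eq_norm, h4, norm_smul, norm_inv, Real.norm_of_nonneg hh2.le, inv_mul_lt_iff₀ hh2]
  nlinarith

end SecondDifference

/-- Multilinearity in the coordinates of `u` passes from the partial derivatives, which have the
moment bounds, to the second derivative along `u`. -/
lemma norm_iteratedFDeriv_two_le {d k : ℕ} (g : RVec d → RVec k) (v u : RVec d) :
    ‖iteratedFDeriv ℝ 2 g v fun _ => u‖
      ≤ (∑ r : Fin 2 → Fin d, ‖partialDeriv r g v‖) * ‖u‖ ^ 2 := by
  have hu : u = ∑ j, u j • EuclideanSpace.single j (1 : ℝ) := by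
    have := (EuclideanSpace.basisFun (Fin d) ℝ).sum_repr u
    simpa using this.symm
  have h1 : (iteratedFDeriv ℝ 2 g v fun _ => u)
      = ∑ r : Fin 2 → Fin d, (∏ l, u (r l)) • partialDeriv r g v := by
    conv_lhs => rw [hu]
    have := (iteratedFDeriv ℝ 2 g v).toMultilinearMap.map_sum
      (fun (_ : Fin 2) (j : Fin d) => u j • EuclideanSpace.single j (1 : ℝ))
    refine this.trans (Finset.sum_congr rfl fun r _ => ?_)
    exact (iteratedFDeriv ℝ 2 g v).toMultilinearMap.map_smul_univ _ _
  rw [h1, Finset.sum_mul]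
  refine (norm_sum_le _ _).trans (Finset.sum_le_sum fun r _ => ?_)
  rw [norm_smul, mul_comm, Fin.prod_univ_two, norm_mul, sq]
  gcongr <;> exact PiLp.norm_apply_le u _

/-- Second-order expansion of averages of `ψ a (a - h u)` with respect to a symmetric kernel. -/
theorem tendsto_integral_second_order {d k : ℕ} {K : RVec d → ℝ} (hK : Measurable K)
    (hsymm : ∀ u, K (-u) = K u) [IsProbabilityMeasure (kernelLaw K)]
    (hK2 : Integrable (fun u => ‖u‖ ^ 2) (kernelLaw K)) {W : Measure (RVec d)}
    [IsProbabilityMeasure W] {ψ : RVec d → RVec d → RVec k} {G : RVec d → ℝ}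
    (hψm : StronglyMeasurable fun q : RVec d × RVec d => ψ q.1 q.2)
    (hψi : ∀ᶠ h in 𝓝[>] (0 : ℝ), Integrable (fun q : RVec d × RVec d => ψ q.1 (q.1 - h • q.2))
      (W.prod (kernelLaw K)))
    (hψ0 : Integrable (fun a => ψ a a) W) (hψ1 : ∫ a, ψ a a ∂W = 0)
    (hψ2 : ∀ᵐ a ∂W, ContDiff ℝ 2 (ψ a)) (hG : Integrable G W)
    (hψG : ∀ᵐ a ∂W, ∀ v u, ‖iteratedFDeriv ℝ 2 (ψ a) v fun _ => u‖ ≤ G a * ‖u‖ ^ 2) :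
    ∃ β : RVec k, Tendsto
      (fun h : ℝ => (h ^ 2)⁻¹ • ∫ q, ψ q.1 (q.1 - h • q.2) ∂W.prod (kernelLaw K)) (𝓝[>] 0)
      (𝓝 β) := by
  set ν := kernelLaw K
  have hψd : Integrable (fun q : RVec d × RVec d => ψ q.1 q.1) (W.prod ν) := hψ0.comp_fst ν
  have hmp : MeasurePreserving (Prod.map id fun u : RVec d => -u) (W.prod ν) (W.prod ν) :=
    (MeasurePreserving.id W).prod (measurePreserving_neg_kernelLaw hK hsymm)
  have hlim := tendsto_integral_filter_of_dominated_convergence (μ := W.prod ν) (l := 𝓝[>] (0 : ℝ))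
    (F := fun (h : ℝ) q => (h ^ 2)⁻¹ • (ψ q.1 (q.1 + h • q.2) + ψ q.1 (q.1 - h • q.2)
      - (2 : ℝ) • ψ q.1 q.1))
    (f := fun q => iteratedFDeriv ℝ 2 (ψ q.1) q.1 fun _ => q.2)
    (fun q => 2 * (G q.1 * ‖q.2‖ ^ 2))
    (Eventually.of_forall fun h => by
      have e1 : StronglyMeasurable fun q : RVec d × RVec d => ψ q.1 (q.1 + h • q.2) :=
        hψm.comp_measurable (g := fun q : RVec d × RVec d => (q.1, q.1 + h • q.2)) (by fun_prop)
      have e2 : StronglyMeasurable fun q : RVec d × RVec d => ψ q.1 (q.1 - h • q.2) :=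
        hψm.comp_measurable (g := fun q : RVec d × RVec d => (q.1, q.1 - h • q.2)) (by fun_prop)
      have e3 : StronglyMeasurable fun q : RVec d × RVec d => ψ q.1 q.1 :=
        hψm.comp_measurable (g := fun q : RVec d × RVec d => (q.1, q.1)) (by fun_prop)
      exact (((e1.add e2).sub (e3.const_smul (2 : ℝ))).const_smul (h ^ 2)⁻¹).aestronglyMeasurable)
    (by
      filter_upwards [self_mem_nhdsWithin] with h hh
      have hh : 0 < h := hh
      filter_upwards [Measure.quasiMeasurePreserving_fst.ae hψG,
        Measure.quasiMeasurePreserving_fst.ae hψ2] with q h1 h2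
      have := norm_second_difference_le h2 q.1 q.2 (fun v => h1 v q.2) hh
      have hh2 : 0 < h ^ 2 := by positivity
      rw [norm_smul, norm_inv, Real.norm_of_nonneg hh2.le, inv_mul_le_iff₀ hh2]
      linarith)
    ((hG.mul_prod hK2).const_mul 2)
    (by
      filter_upwards [Measure.quasiMeasurePreserving_fst.ae hψ2] with q h2
      exact tendsto_second_difference h2 q.1 q.2)
  -- Reflection `u ↦ -u` gives `ψ(a, a + h u)` and `ψ(a, a - h u)` the same average, hence the
  -- factor `1 / 2`.
  refine ⟨_, ((hlim.const_smul (1 / 2 : ℝ)).congr' ?_)⟩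
  filter_upwards [hψi] with h hi
  have hi' : Integrable (fun q : RVec d × RVec d => ψ q.1 (q.1 + h • q.2)) (W.prod ν) := by
    have := hmp.integrable_comp_of_integrable hi
    simpa [Function.comp_def] using this
  have heq : ∫ q, ψ q.1 (q.1 + h • q.2) ∂W.prod ν = ∫ q, ψ q.1 (q.1 - h • q.2) ∂W.prod ν := by
    have := hmp.integral_comp' (f := (MeasurableEquiv.refl (RVec d)).prodCongr
      (MeasurableEquiv.neg (RVec d))) (fun q : RVec d × RVec d => ψ q.1 (q.1 - h • q.2))
    rw [← this]
    congr 1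
    ext1 q
    change _ = ψ q.1 (q.1 - h • (-q.2))
    rw [smul_neg, sub_neg_eq_add]
  have hdiag : ∫ q, ψ q.1 q.1 ∂W.prod ν = 0 := by
    rw [integral_fun_fst (μ := W) (ν := ν) (fun a => ψ a a), hψ1, smul_zero]
  have hsum : ∫ q, (ψ q.1 (q.1 + h • q.2) + ψ q.1 (q.1 - h • q.2) - (2 : ℝ) • ψ q.1 q.1)
      ∂W.prod ν = ∫ q, ψ q.1 (q.1 + h • q.2) ∂W.prod ν + ∫ q, ψ q.1 (q.1 - h • q.2) ∂W.prod ν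
      - (2 : ℝ) • ∫ q, ψ q.1 q.1 ∂W.prod ν := by
    rw [← integral_add hi' hi, ← integral_smul]
    exact integral_sub (hi'.add hi) (hψd.smul (2 : ℝ))
  rw [integral_smul, hsum, hdiag, heq, ← two_smul ℝ, smul_zero, sub_zero, smul_smul, smul_smul]
  congr 1
  ring

/-! ### Consequences of the assumptions -/

lemma FiniteMean.exists_integrable {α : Type*} [MeasurableSpace α] {μ : Measure α}
    {g : α → ℝ≥0∞} (hg : FiniteMean μ g) :
    ∃ G : α → ℝ, Integrable G μ ∧ (∀ x, 0 ≤ G x) ∧ ∀ᵐ x ∂μ, g x ≤ ENNReal.ofReal (G x) := by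
  obtain ⟨G, hGm, hgG, hG⟩ := hg
  refine ⟨fun x => (G x).toReal, integrable_toReal_of_lintegral_ne_top hGm.aemeasurable hG.ne,
    fun x => ENNReal.toReal_nonneg, ?_⟩
  filter_upwards [hgG, ae_lt_top hGm hG.ne] with x h1 h2
  rwa [ENNReal.ofReal_toReal h2.ne]

/-! ### Quadratic forms: continuity, bounds and integration -/

section QuadForm

variable {k : ℕ}

lemma continuous_quadForm (t : RVec k) :
    Continuous fun A : Matrix (Fin k) (Fin k) ℝ => quadForm A t := by
  unfold quadForm
  fun_prop

lemma quadForm_smul (c : ℝ) (A : Matrix (Fin k) (Fin k) ℝ) (t : RVec k) :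
    quadForm (c • A) t = c * quadForm A t := by
  simp only [quadForm, Finset.mul_sum, Matrix.smul_apply, smul_eq_mul]
  exact Finset.sum_congr rfl fun i _ => Finset.sum_congr rfl fun j _ => by ring

lemma abs_apply_le_matNorm (A : Matrix (Fin k) (Fin k) ℝ) (i j : Fin k) :
    |A i j| ≤ matNorm A := by
  rw [← Real.sqrt_sq_eq_abs, matNorm]
  refine Real.sqrt_le_sqrt ?_
  have h1 : A i j ^ 2 ≤ ∑ j, A i j ^ 2 :=
    Finset.single_le_sum (f := fun j => A i j ^ 2) (fun j _ => sq_nonneg _) (Finset.mem_univ j)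
  exact h1.trans (Finset.single_le_sum (f := fun i => ∑ j, A i j ^ 2)
    (fun i _ => Finset.sum_nonneg fun j _ => sq_nonneg _) (Finset.mem_univ i))

lemma abs_quadForm_le (A : Matrix (Fin k) (Fin k) ℝ) (t : RVec k) :
    |quadForm A t| ≤ (∑ i, ∑ j, |t i| * |t j|) * matNorm A := by
  rw [quadForm, Finset.sum_mul]
  refine (Finset.abs_sum_le_sum_abs _ _).trans (Finset.sum_le_sum fun i _ => ?_)
  rw [Finset.sum_mul]
  refine (Finset.abs_sum_le_sum_abs _ _).trans (Finset.sum_le_sum fun j _ => ?_)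
  rw [abs_mul, abs_mul, mul_right_comm]
  gcongr
  exact abs_apply_le_matNorm A i j

lemma integrable_quadForm {α : Type*} [MeasurableSpace α] {μ : Measure α}
    {A : α → Matrix (Fin k) (Fin k) ℝ} (hA : ∀ i j, Integrable (fun a => A a i j) μ) (t : RVec k) :
    Integrable (fun a => quadForm (A a) t) μ :=
  integrable_finsetSum _ fun i _ => integrable_finsetSum _ fun j _ =>
    ((hA i j).const_mul (t i)).mul_const (t j)

lemma integral_quadForm {α : Type*} [MeasurableSpace α] {μ : Measure α}
    {A : α → Matrix (Fin k) (Fin k) ℝ} (hA : ∀ i j, Integrable (fun a => A a i j) μ) (t : RVec k) :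
    ∫ a, quadForm (A a) t ∂μ = quadForm (Matrix.of fun i j => ∫ a, A a i j ∂μ) t := by
  unfold quadForm
  rw [integral_finsetSum _ fun i _ => integrable_finsetSum _ fun j _ =>
    ((hA i j).const_mul (t i)).mul_const (t j)]
  refine Finset.sum_congr rfl fun i _ => ?_
  rw [integral_finsetSum _ fun j _ => ((hA i j).const_mul (t i)).mul_const (t j)]
  refine Finset.sum_congr rfl fun j _ => ?_
  rw [integral_mul_const, integral_const_mul, Matrix.of_apply]

end QuadForm

/-! ### Limits and dominating functions drawn from the assumptions -/

section

variable {d k : ℕ} {Z : Type*} [MeasurableSpace Z] {D : Population d Z}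
  {m : Z → Z → RVec k → ℝ} {Θ : Set (RVec k)} {K : RVec d → ℝ} {θ₀ : RVec k}
  {s : Z → Z → RVec k → RVec k}
  {H : RVec d → RVec d → RVec k → RVec k → Matrix (Fin k) (Fin k) ℝ}

lemma Population.lawW_absolutelyContinuous : D.lawW ≪ volume := by
  rw [Population.lawW, D.law_w]
  exact withDensity_absolutelyContinuous _ _

lemma Population.ae_mem_supp : ∀ᵐ a ∂D.lawW, a ∈ D.supp := Measure.support_mem_ae

lemma Population.ae_f_pos : ∀ᵐ a ∂D.lawW, 0 < D.f a := by
  have hf := D.measurable_f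
  rw [Population.lawW, D.law_w, ae_withDensity_iff (by fun_prop)]
  exact Eventually.of_forall fun a ha => by simpa using ha

lemma Population.isClosed_supp : IsClosed D.supp := Measure.isClosed_support

lemma Population.f_eq_zero_of_notMem {a : RVec d} (ha : a ∉ D.supp) : D.f a = 0 :=
  D.f_eq_zero a ha

/-- Every `a` in the support is a limit of points `v ≠ a` of the support in any set of full
measure. -/
lemma Population.neBot_nhds_inf_ae (hd : 0 < d) {a : RVec d} (ha : a ∈ D.supp) :
    (𝓝 a ⊓ ae D.lawW).NeBot ∧ 𝓝 a ⊓ ae D.lawW ≤ 𝓝[D.supp \ {a}] a := by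
  constructor
  · rw [inf_neBot_iff]
    intro U hU V hV
    have hpos := (Measure.mem_support_iff_forall a).1 ha U hU
    by_contra hne
    rw [Set.not_nonempty_iff_eq_empty, ← Set.disjoint_iff_inter_eq_empty] at hne
    have : D.lawW U ≤ D.lawW Vᶜ := measure_mono hne.subset_compl_right
    rw [mem_ae_iff.1 hV] at this
    exact hpos.ne' (le_antisymm this bot_le)
  · refine le_inf inf_le_left (inf_le_right.trans (le_principal_iff.2 ?_))
    have : Nonempty (Fin d) := ⟨⟨0, hd⟩⟩
    have h1 : D.lawW {a} = 0 := Population.lawW_absolutelyContinuous (measure_singleton a)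
    exact inter_mem Population.ae_mem_supp (compl_mem_ae_iff.2 h1)

lemma DerivativeConditions.integrable_s (hs : DerivativeConditions D m s H θ₀) :
    Integrable (fun p : Z × Z => s p.1 p.2 θ₀) D.pairLaw := by
  obtain ⟨δ, hδ, b, hb, hsb, hb4, -⟩ := hs.moments
  have hb4i : Integrable (fun z => b z ^ 4) D.P :=
    ⟨by fun_prop, (hasFiniteIntegral_iff_ofReal (Eventually.of_forall fun z => by positivity)).2 hb4⟩
  -- From `|b| ≤ 1 + b⁴`.
  have hbi : Integrable b D.P := by
    refine ((integrable_const (1 : ℝ)).add hb4i).mono' hb.aestronglyMeasurable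
      (Eventually.of_forall fun z => ?_)
    rw [Real.norm_eq_abs, Pi.add_apply, abs_le]
    constructor <;> nlinarith [sq_nonneg (b z ^ 2 - 1 / 2), sq_nonneg (b z - 1),
      sq_nonneg (b z + 1)]
  refine (hbi.mul_prod hbi).mono' (hs.s_measurable θ₀).aestronglyMeasurable ?_
  filter_upwards [hsb] with p hp
  exact hp θ₀ (Metric.mem_ball_self hδ)

lemma measurable_remr (hM : ConvergenceOfM D m Θ K θ₀) (hs : DerivativeConditions D m s H θ₀)
    {t : RVec k} {τ : ℝ} (ht : θ₀ + τ • t ∈ Θ) :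
    Measurable fun p : Z × Z => remr m s t θ₀ τ p.1 p.2 := by
  have h1 := hM.m_measurable _ ht
  have h2 := hM.m_measurable _ (interior_subset hM.θ₀_interior)
  have h3 := hs.s_measurable θ₀
  unfold remr
  fun_prop

lemma integrable_remr {t : RVec k} {τ : ℝ} {μ : Measure (Z × Z)}
    (h1 : Integrable (fun p : Z × Z => m p.1 p.2 (θ₀ + τ • t)) μ)
    (h2 : Integrable (fun p : Z × Z => m p.1 p.2 θ₀) μ)
    (h3 : Integrable (fun p : Z × Z => s p.1 p.2 θ₀) μ) :
    Integrable (fun p : Z × Z => remr m s t θ₀ τ p.1 p.2) μ :=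
  ((h1.sub h2).div_const τ).sub (h3.inner_const t)

/-- The directions in which `θ₀` can be moved. -/
lemma ConvergenceOfM.eventually_mem (hM : ConvergenceOfM D m Θ K θ₀) (t : RVec k) :
    ∀ᶠ τ in 𝓝[>] (0 : ℝ), θ₀ + τ • t ∈ Θ := by
  have h1 : Tendsto (fun τ : ℝ => θ₀ + τ • t) (𝓝 0) (𝓝 (θ₀ + (0 : ℝ) • t)) :=
    Continuous.tendsto (by fun_prop) 0
  rw [zero_smul, add_zero] at h1
  exact (h1.mono_left nhdsWithin_le_nhds).eventually (mem_interior_iff_mem_nhds.1 hM.θ₀_interior)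

lemma ConvergenceOfM.tendsto_f (hM : ConvergenceOfM D m Θ K θ₀) :
    ∀ᵐ a ∂D.lawW, Tendsto D.f (𝓝[D.supp] a) (𝓝 (D.f a)) := by
  filter_upwards [Population.ae_mem_supp] with a ha using hM.f_continuousOn a ha

/-- The assumed limit carries the weight `f(a)`, while the change of variables produces `f(v)`; the
ratio tends to one since `f(a) > 0` almost surely. -/
lemma tendsto_f_mul_quadForm (hM : ConvergenceOfM D m Θ K θ₀)
    {G₀ : RVec d → Matrix (Fin k) (Fin k) ℝ} {t : RVec k}
    (hG₀ : ∀ᵐ a ∂D.lawW, Tendsto (fun q : RVec k × RVec d => D.f a • H a q.2 q.1 t)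
      (limThetaV D.supp θ₀ a) (𝓝 (G₀ a))) :
    ∀ᵐ a ∂D.lawW, Tendsto (fun v => D.f v * quadForm (H a v θ₀ t) t) (𝓝[D.supp \ {a}] a)
      (𝓝 (quadForm (G₀ a) t)) := by
  filter_upwards [hG₀, Population.ae_f_pos (D := D), hM.tendsto_f] with a h1 h2 h3
  have h4 : Tendsto (fun v : RVec d => (θ₀, v)) (𝓝[D.supp \ {a}] a) (limThetaV D.supp θ₀ a) := by
    refine tendsto_nhdsWithin_iff.2 ⟨?_, ?_⟩
    · exact (Continuous.tendsto (by fun_prop) a).mono_left nhdsWithin_le_nhds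
    · filter_upwards [self_mem_nhdsWithin] with v hv
      exact ⟨hv.1, fun h => hv.2 (Prod.ext_iff.1 h).2⟩
  have h5 := ((continuous_quadForm t).tendsto _).comp (h1.comp h4)
  have h6 := (h3.mono_left (nhdsWithin_mono a (Set.sdiff_subset (t := {a})))).div_const (D.f a)
  rw [div_self h2.ne'] at h6
  have h7 := h6.mul h5
  rw [one_mul] at h7
  refine h7.congr fun v => ?_
  simp only [Function.comp_apply, quadForm_smul]
  field_simp

/-- The difference quotient of `θ ↦ E[m(z₁, z₂; θ) | w₁, w₂]`, for almost all values of
`w₁, w₂`. -/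
lemma ae_condPair_sub (hM : ConvergenceOfM D m Θ K θ₀) (hs : DerivativeConditions D m s H θ₀)
    {t : RVec k} {τ : ℝ} (hτ : 0 < τ) (ht : θ₀ + τ • t ∈ Θ) :
    ∀ᵐ q ∂D.lawW.prod D.lawW,
      D.f q.2 * (D.condPair (fun x y => m x y (θ₀ + τ • t)) q.1 q.2
        - D.condPair (fun x y => m x y θ₀) q.1 q.2)
      = τ * (D.f q.2 * D.condPair (remr m s t θ₀ τ) q.1 q.2
        + inner ℝ (D.ψ s θ₀ q.1 q.2) t) := by
  have hθ : θ₀ ∈ Θ := interior_subset hM.θ₀_interior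
  filter_upwards [D.ae_integrable_condPairLaw (g := fun x y => m x y (θ₀ + τ • t))
      (hM.m_measurable _ ht).stronglyMeasurable
      (hM.m_integrable _ ht),
    D.ae_integrable_condPairLaw (g := fun x y => m x y θ₀)
      (hM.m_measurable _ hθ).stronglyMeasurable (hM.m_integrable _ hθ),
    D.ae_integrable_condPairLaw (g := fun x y => s x y θ₀) (hs.s_measurable θ₀).stronglyMeasurable hs.integrable_s]
    with q h1 h2 h3
  have h4 : D.condPair (remr m s t θ₀ τ) q.1 q.2
      = (D.condPair (fun x y => m x y (θ₀ + τ • t)) q.1 q.2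
        - D.condPair (fun x y => m x y θ₀) q.1 q.2) / τ
        - inner ℝ (D.condPair (fun x y => s x y θ₀) q.1 q.2) t := by
    unfold Population.condPair remr
    have h5 := integral_sub ((h1.sub h2).div_const τ) (h3.inner_const (𝕜 := ℝ) t)
    have h6 : ∫ p, inner ℝ (s p.1 p.2 θ₀) t ∂D.condPairLaw q.1 q.2
        = inner ℝ (∫ p, s p.1 p.2 θ₀ ∂D.condPairLaw q.1 q.2) t := by
      rw [real_inner_comm, ← integral_inner h3]
      simp_rw [real_inner_comm]
    rw [← h6, ← integral_sub h1 h2, ← integral_div]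
    exact h5
  rw [h4, Population.ψ, real_inner_smul_left]
  field_simp
  ring

/-- The law of `w` absorbs one of the two factors in `f(a)²`. -/
lemma Population.integrable_M₀Integrand (hM : ConvergenceOfM D m Θ K θ₀) {θ : RVec k}
    (hθ : θ ∈ Θ) :
    Integrable (fun a => D.f a * D.condPair (fun x y => m x y θ) a a) D.lawW ∧
    ∫ a, D.f a * D.condPair (fun x y => m x y θ) a a ∂D.lawW = D.M₀ m θ := by
  have hf := D.measurable_f
  have h0 : ∀ a, a ∉ D.supp → D.M₀Integrand m θ a = 0 := fun a ha => by
    simp [Population.M₀Integrand, D.f_eq_zero_of_notMem ha]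
  have h1 : ∀ a, (ENNReal.ofReal (D.f a)).toReal • (D.f a * D.condPair (fun x y => m x y θ) a a)
      = D.M₀Integrand m θ a := fun a => by
    rw [ENNReal.toReal_ofReal (D.f_nonneg a), Population.M₀Integrand, smul_eq_mul]; ring
  constructor
  · rw [Population.lawW, D.law_w, integrable_withDensity_iff_integrable_smul' (by fun_prop)
      (by simp)]
    simp_rw [h1]
    exact (integrableOn_iff_integrable_of_support_subset
      (Function.support_subset_iff'.2 h0)).1 (hM.M₀_integrable θ hθ)
  · rw [Population.M₀, setIntegral_eq_integral_of_forall_compl_eq_zero h0, Population.lawW, D.law_w,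
      integral_withDensity_eq_integral_toReal_smul (by fun_prop) (by simp)]
    simp_rw [h1]

lemma Population.ψ_eq_zero {a v : RVec d} (hv : v ∉ D.supp) : D.ψ s θ₀ a v = 0 := by
  rw [Population.ψ, D.f_eq_zero_of_notMem hv, zero_smul]

lemma DerivativeConditions.stronglyMeasurable_ψ (hs : DerivativeConditions D m s H θ₀) :
    StronglyMeasurable fun q : RVec d × RVec d => D.ψ s θ₀ q.1 q.2 := by
  have hf := D.measurable_f
  have h1 : StronglyMeasurable fun q : RVec d × RVec d => D.f q.2 :=
    (by fun_prop : Measurable fun q : RVec d × RVec d => D.f q.2).stronglyMeasurable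
  exact h1.smul (D.stronglyMeasurable_condPair (hs.s_measurable θ₀).stronglyMeasurable)

lemma SmoothPsi.integrable_diag (hψ : SmoothPsi D s θ₀) (hs : DerivativeConditions D m s H θ₀) :
    Integrable (fun a => D.ψ s θ₀ a a) D.lawW := by
  obtain ⟨G, hG, -, hGψ⟩ := (hψ.2 0 (by norm_num) Fin.elim0).exists_integrable
  have hm : StronglyMeasurable fun a => D.ψ s θ₀ a a :=
    hs.stronglyMeasurable_ψ.comp_measurable (g := fun a => (a, a)) (by fun_prop)
  refine hG.abs.mono' hm.aestronglyMeasurable ?_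
  filter_upwards [hGψ, Population.ae_mem_supp (D := D)] with a h1 h2
  have h3 := (le_iSup₂ (f := fun v (_ : v ∈ D.supp) =>
    ‖partialDeriv (Fin.elim0 : Fin 0 → Fin d) (D.ψ s θ₀ a) v‖ₑ) a h2).trans h1
  rw [partialDeriv, iteratedFDeriv_zero_apply, ← ofReal_norm] at h3
  exact (ENNReal.ofReal_le_ofReal_iff'.1 h3).elim (fun h => h.trans (le_abs_self _))
    (fun h => h.trans (abs_nonneg _))

/-- The assumption bounds derivatives on the support only. Its complement is open and `ψ` vanishes
there, so the derivatives do too and the bound holds for every `v`. -/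
lemma SmoothPsi.exists_bound (hψ : SmoothPsi D s θ₀) :
    ∃ G : RVec d → ℝ, Integrable G D.lawW ∧ ∀ᵐ a ∂D.lawW, ∀ v u,
      ‖iteratedFDeriv ℝ 2 (D.ψ s θ₀ a) v fun _ => u‖ ≤ G a * ‖u‖ ^ 2 := by
  choose G hG hG0 hGψ using fun r : Fin 2 → Fin d => (hψ.2 2 le_rfl r).exists_integrable
  refine ⟨fun a => ∑ r, G r a, integrable_finsetSum _ fun r _ => hG r, ?_⟩
  filter_upwards [ae_all_iff.2 hGψ] with a ha v u
  by_cases hv : v ∈ D.supp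
  · refine (norm_iteratedFDeriv_two_le _ v u).trans ?_
    gcongr with r
    have h3 := (le_iSup₂ (f := fun v (_ : v ∈ D.supp) =>
      ‖partialDeriv r (D.ψ s θ₀ a) v‖ₑ) v hv).trans (ha r)
    rw [← ofReal_norm] at h3
    exact (ENNReal.ofReal_le_ofReal_iff (hG0 r a)).1 h3
  · have h1 : D.ψ s θ₀ a =ᶠ[𝓝 v] fun _ => 0 := by
      filter_upwards [D.isClosed_supp.isOpen_compl.mem_nhds hv] with v' hv'
      exact Population.ψ_eq_zero hv'
    have h2 := h1.iteratedFDeriv (𝕜 := ℝ) 2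
    rw [h2.eq_of_nhds]
    have : (0 : ℝ) ≤ (∑ r, G r a) * ‖u‖ ^ 2 :=
      mul_nonneg (Finset.sum_nonneg fun r _ => hG0 r a) (by positivity)
    simpa using this

lemma DerivativeConditions.exists_remR_bound (hs : DerivativeConditions D m s H θ₀) (t : RVec k) :
    ∃ δ > 0, ∃ G : RVec d → ℝ, Integrable G D.lawW ∧ ∀ᵐ a ∂D.lawW, ∀ τ ∈ Set.Ioo 0 δ,
      ∀ v ∈ D.supp, D.f v * |D.remR (remr m s t) H t θ₀ τ a v| ≤ G a := by
  obtain ⟨δ, hδ, -, -, h⟩ := hs.rem_sup t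
  obtain ⟨G, hG, hG0, hGr⟩ := h.exists_integrable
  refine ⟨δ, hδ, G, hG, ?_⟩
  filter_upwards [hGr] with a ha τ hτ v hv
  have h1 : ENNReal.ofReal (|D.remR (remr m s t) H t θ₀ τ a v| * D.f v) ≤ ENNReal.ofReal (G a) := by
    refine le_trans ?_ ha
    refine le_iSup₂_of_le τ hτ (le_iSup₂_of_le θ₀ (Metric.mem_ball_self hδ) ?_)
    exact le_iSup₂_of_le v hv le_rfl
  rw [mul_comm]
  exact (ENNReal.ofReal_le_ofReal_iff (hG0 a)).1 h1

lemma DerivativeConditions.exists_H_bound (hs : DerivativeConditions D m s H θ₀) (t : RVec k) :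
    ∃ G : RVec d → ℝ, Integrable G D.lawW ∧ ∀ᵐ a ∂D.lawW, ∀ v ∈ D.supp,
      D.f v * |quadForm (H a v θ₀ t) t| ≤ G a := by
  obtain ⟨δ, hδ, b, -, -, -, -, h⟩ := hs.moments
  obtain ⟨G, hG, hG0, hGr⟩ := (h t).exists_integrable
  refine ⟨fun a => (∑ i, ∑ j, |t i| * |t j|) * G a, hG.const_mul _, ?_⟩
  filter_upwards [hGr] with a ha v hv
  have h1 : ENNReal.ofReal (matNorm (H a v θ₀ t) * D.f v) ≤ ENNReal.ofReal (G a) := by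
    refine le_trans ?_ ha
    refine le_iSup₂_of_le θ₀ (Metric.mem_ball_self hδ) ?_
    exact le_iSup₂_of_le v hv le_rfl
  have h2 := (ENNReal.ofReal_le_ofReal_iff (hG0 a)).1 h1
  have h3 : 0 ≤ ∑ i, ∑ j, |t i| * |t j| :=
    Finset.sum_nonneg fun i _ => Finset.sum_nonneg fun j _ => by positivity
  calc D.f v * |quadForm (H a v θ₀ t) t|
      ≤ D.f v * ((∑ i, ∑ j, |t i| * |t j|) * matNorm (H a v θ₀ t)) :=
        mul_le_mul_of_nonneg_left (abs_quadForm_le _ _) (D.f_nonneg v)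
    _ = (∑ i, ∑ j, |t i| * |t j|) * (matNorm (H a v θ₀ t) * D.f v) := by ring
    _ ≤ _ := mul_le_mul_of_nonneg_left h2 h3

end

/-! ### The first-order condition and the expansion of the objective -/

section

variable {d k : ℕ} {Z : Type*} [MeasurableSpace Z] {D : Population d Z}
  {m : Z → Z → RVec k → ℝ} {Θ : Set (RVec k)} {K : RVec d → ℝ} {θ₀ : RVec k}
  {s : Z → Z → RVec k → RVec k}
  {H : RVec d → RVec d → RVec k → RVec k → Matrix (Fin k) (Fin k) ℝ}

lemma condPair_remr_eq {t : RVec k} {τ : ℝ} (hτ : 0 < τ) (a v : RVec d) :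
    D.condPair (remr m s t θ₀ τ) a v
      = τ * (D.remR (remr m s t) H t θ₀ τ a v + 1 / 2 * quadForm (H a v θ₀ t) t) := by
  rw [Population.remR, sub_add_cancel, mul_div_cancel₀ _ hτ.ne']

/-- A quadratic bound on the diagonal for the remainder of the expansion of
`E[m(z₁, z₂; θ) | w₁ = a, w₂ = a]`. It is obtained from values `w₂ ≠ a`. -/
lemma abs_diag_expansion_le (hd : 0 < d) (hM : ConvergenceOfM D m Θ K θ₀)
    (hs : DerivativeConditions D m s H θ₀) (hψ : SmoothPsi D s θ₀)
    {G₀ : RVec d → Matrix (Fin k) (Fin k) ℝ} {t : RVec k}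
    (hG₀ : ∀ᵐ a ∂D.lawW, Tendsto (fun q : RVec k × RVec d => D.f a • H a q.2 q.1 t)
      (limThetaV D.supp θ₀ a) (𝓝 (G₀ a)))
    {G : RVec d → ℝ} {τ : ℝ} (hτ : 0 < τ) (ht : θ₀ + τ • t ∈ Θ)
    (hG : ∀ᵐ a ∂D.lawW, ∀ v ∈ D.supp, D.f v * |D.remR (remr m s t) H t θ₀ τ a v| ≤ G a) :
    ∀ᵐ a ∂D.lawW,
      |D.f a * D.condPair (fun x y => m x y (θ₀ + τ • t)) a a
        - D.f a * D.condPair (fun x y => m x y θ₀) a a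
        - τ * (τ * (1 / 2 * quadForm (G₀ a) t) + inner ℝ (D.ψ s θ₀ a a) t)| ≤ τ ^ 2 * G a := by
  have hθ : θ₀ ∈ Θ := interior_subset hM.θ₀_interior
  filter_upwards [Population.ae_mem_supp (D := D), Measure.ae_ae_of_ae_prod (ae_condPair_sub hM hs hτ ht),
    hG, hψ.1, hM.tendsto_f, tendsto_f_mul_quadForm hM hG₀, hM.m_lim _ ht, hM.m_lim _ hθ]
    with a ha h1 h2 h3 h4 h5 h6 h7
  -- The difference-quotient identity holds for almost every `v`, and the limit `G₀` excludes `v =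
  -- a`. This filter meets both restrictions, and it is nontrivial because `a` is in the support.
  obtain ⟨hne, hle⟩ := D.neBot_nhds_inf_ae hd ha
  have hle' : 𝓝 a ⊓ ae D.lawW ≤ 𝓝[D.supp] a :=
    hle.trans (nhdsWithin_mono a Set.sdiff_subset)
  have h8 : Tendsto (fun v => inner ℝ (D.ψ s θ₀ a v) t) (𝓝 a ⊓ ae D.lawW)
      (𝓝 (inner ℝ (D.ψ s θ₀ a a) t)) := by
    have hc : Continuous fun v => (inner ℝ (D.ψ s θ₀ a v) t : ℝ) := h3.continuous.inner continuous_const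
    exact (hc.tendsto a).mono_left inf_le_left
  have h4' := h4.mono_left hle'
  have hlim := ((((h4'.mul (h6.mono_left hle')).sub (h4'.mul (h7.mono_left hle'))).sub
    (((((h5.mono_left hle).const_mul (1 / 2)).const_mul τ).add h8).const_mul τ))).abs
  refine le_of_tendsto hlim ?_
  have hae : ∀ᶠ v in 𝓝 a ⊓ ae D.lawW, v ∈ D.supp := hle' self_mem_nhdsWithin
  filter_upwards [hae, (inf_le_right : 𝓝 a ⊓ ae D.lawW ≤ _) h1] with v hv hv1
  have hv1 : D.f v * (D.condPair (fun x y => m x y (θ₀ + τ • t)) a v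
        - D.condPair (fun x y => m x y θ₀) a v)
      = τ * (D.f v * D.condPair (remr m s t θ₀ τ) a v + inner ℝ (D.ψ s θ₀ a v) t) := hv1
  rw [condPair_remr_eq (H := H) hτ] at hv1
  have h9 : D.f v * D.condPair (fun x y => m x y (θ₀ + τ • t)) a v
        - D.f v * D.condPair (fun x y => m x y θ₀) a v
        - τ * (τ * (1 / 2 * (D.f v * quadForm (H a v θ₀ t) t)) + inner ℝ (D.ψ s θ₀ a v) t)
      = τ ^ 2 * (D.f v * D.remR (remr m s t) H t θ₀ τ a v) := by
    linear_combination hv1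
  rw [h9, abs_mul, abs_of_pos (by positivity : 0 < τ ^ 2), abs_mul, abs_of_nonneg (D.f_nonneg v)]
  exact mul_le_mul_of_nonneg_left (h2 v hv) (by positivity)

/-- The first-order condition: `E[s(z₁, z₂; θ₀) | w₁ = w, w₂ = w] f(w)` has mean zero. -/
theorem integral_ψ_diag_eq_zero (hd : 0 < d) (hM : ConvergenceOfM D m Θ K θ₀)
    (hs : DerivativeConditions D m s H θ₀) (hψ : SmoothPsi D s θ₀) :
    ∫ a, D.ψ s θ₀ a a ∂D.lawW = 0 := by
  have hθ : θ₀ ∈ Θ := interior_subset hM.θ₀_interior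
  obtain ⟨G₀, ξ₀, Ξ₀, hV⟩ := hs.variance
  have hψi := hψ.integrable_diag hs
  have key : ∀ t : RVec k, 0 ≤ (inner ℝ (∫ a, D.ψ s θ₀ a a ∂D.lawW) t : ℝ) := by
    intro t
    obtain ⟨δ, hδ, G, hG, hGr⟩ := hs.exists_remR_bound t
    have hqi := integrable_quadForm hV.G₀_integrable t
    -- The remainder is only bounded here, which suffices: after division by `τ` its contribution is
    -- still of order `τ`.
    set c : ℝ := 1 / 2 * ∫ a, quadForm (G₀ a) t ∂D.lawW + ∫ a, G a ∂D.lawW with hc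
    have hψt : ∫ a, inner ℝ (D.ψ s θ₀ a a) t ∂D.lawW
        = inner ℝ (∫ a, D.ψ s θ₀ a a ∂D.lawW) t := by
      rw [real_inner_comm, ← integral_inner hψi]
      simp_rw [real_inner_comm]
    have h1 : ∀ᶠ τ in 𝓝[>] (0 : ℝ),
        0 ≤ τ * c + (inner ℝ (∫ a, D.ψ s θ₀ a a ∂D.lawW) t : ℝ) := by
      filter_upwards [Ioo_mem_nhdsGT hδ, hM.eventually_mem t] with τ hτ ht
      have hτ0 : 0 < τ := hτ.1
      obtain ⟨i1, e1⟩ := Population.integrable_M₀Integrand hM ht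
      obtain ⟨i2, e2⟩ := Population.integrable_M₀Integrand hM hθ
      have hmin : D.M₀ m θ₀ ≤ D.M₀ m (θ₀ + τ • t) := by
        by_cases h : θ₀ + τ • t = θ₀
        · rw [h]
        · exact (hM.θ₀_unique_min _ ht h).le
      have hb := abs_diag_expansion_le hd hM hs hψ (hV.G₀_lim t) hτ0 ht
        (hGr.mono fun a ha v hv => ha τ hτ v hv)
      have i3 : Integrable (fun a => τ * (τ * (1 / 2 * quadForm (G₀ a) t)
          + inner ℝ (D.ψ s θ₀ a a) t)) D.lawW :=
        (((hqi.const_mul (1 / 2)).const_mul τ).add (hψi.inner_const t)).const_mul τ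
      have i4 : Integrable (fun a => τ ^ 2 * G a) D.lawW := hG.const_mul _
      have h2 : ∫ a, (D.f a * D.condPair (fun x y => m x y (θ₀ + τ • t)) a a
          - D.f a * D.condPair (fun x y => m x y θ₀) a a) ∂D.lawW
          ≤ ∫ a, (τ * (τ * (1 / 2 * quadForm (G₀ a) t) + inner ℝ (D.ψ s θ₀ a a) t)
            + τ ^ 2 * G a) ∂D.lawW := by
        refine integral_mono_ae (i1.sub i2) (i3.add i4) ?_
        filter_upwards [hb] with a ha
        have := (abs_le.1 ha).2
        linarith
      rw [integral_sub i1 i2, e1, e2, integral_add i3 i4, integral_const_mul,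
        integral_add ((hqi.const_mul (1 / 2)).const_mul τ) (hψi.inner_const t), integral_const_mul,
        integral_const_mul, integral_const_mul, hψt] at h2
      have h3 : 0 ≤ τ * (τ * c + (inner ℝ (∫ a, D.ψ s θ₀ a a ∂D.lawW) t : ℝ)) := by
        rw [hc]
        nlinarith
      exact nonneg_of_mul_nonneg_right h3 hτ0
    have h2 : Tendsto (fun τ : ℝ => τ * c + (inner ℝ (∫ a, D.ψ s θ₀ a a ∂D.lawW) t : ℝ)) (𝓝[>] 0)
        (𝓝 (0 * c + (inner ℝ (∫ a, D.ψ s θ₀ a a ∂D.lawW) t : ℝ))) :=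
      (Continuous.tendsto (by fun_prop) 0).mono_left nhdsWithin_le_nhds
    have := ge_of_tendsto h2 h1
    rwa [zero_mul, zero_add] at this
  -- The direction opposite to the mean turns the inequality into `-‖·‖² ≥ 0`.
  have h := key (-∫ a, D.ψ s θ₀ a a ∂D.lawW)
  rw [inner_neg_right, neg_nonneg] at h
  rw [real_inner_self_eq_norm_sq] at h
  exact norm_eq_zero.1 (pow_eq_zero_iff two_ne_zero |>.1 (le_antisymm h (sq_nonneg _)))

lemma ConvergenceOfM.isProbabilityMeasure_kernelLaw (hM : ConvergenceOfM D m Θ K θ₀) :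
    IsProbabilityMeasure (kernelLaw K) := by
  constructor
  rw [kernelLaw, withDensity_apply _ MeasurableSet.univ, Measure.restrict_univ]
  exact hM.K_integral

lemma tendsto_sq_nhdsGT_zero : Tendsto (fun h : ℝ => h ^ 2) (𝓝[>] 0) (𝓝[>] 0) := by
  refine tendsto_nhdsWithin_iff.2 ⟨?_, ?_⟩
  · have : Tendsto (fun h : ℝ => h ^ 2) (𝓝 0) (𝓝 (0 ^ 2)) := (continuous_pow 2).tendsto 0
    rw [zero_pow two_ne_zero] at this
    exact this.mono_left nhdsWithin_le_nhds
  · filter_upwards [self_mem_nhdsWithin] with h hh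
    have hh : 0 < h := hh
    exact pow_pos hh 2

/-- The limit of the average remainder. -/
lemma tendsto_integral_remr (hd : 0 < d) (hM : ConvergenceOfM D m Θ K θ₀)
    (hs : DerivativeConditions D m s H θ₀)
    {G₀ : RVec d → Matrix (Fin k) (Fin k) ℝ}
    (hG₀i : ∀ i j, Integrable (fun a => G₀ a i j) D.lawW) {t : RVec k}
    (hG₀ : ∀ᵐ a ∂D.lawW, Tendsto (fun q : RVec k × RVec d => D.f a • H a q.2 q.1 t)
      (limThetaV D.supp θ₀ a) (𝓝 (G₀ a))) :
    Tendsto (fun h : ℝ => ∫ q, D.f (q.1 - h • q.2) *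
        (D.condPair (remr m s t θ₀ (h ^ 2)) q.1 (q.1 - h • q.2) / h ^ 2)
        ∂D.lawW.prod (kernelLaw K)) (𝓝[>] 0)
      (𝓝 (1 / 2 * quadForm (Matrix.of fun i j => ∫ a, G₀ a i j ∂D.lawW) t)) := by
  have := hM.isProbabilityMeasure_kernelLaw
  have hf := D.measurable_f
  obtain ⟨C, hC⟩ := hM.K_bounded
  obtain ⟨δ, hδ, G, hG, hGr⟩ := hs.exists_remR_bound t
  obtain ⟨G', hG', hGH⟩ := hs.exists_H_bound t
  have hsq := tendsto_sq_nhdsGT_zero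
  have hsplit : ∀ h : ℝ, 0 < h → ∀ a v : RVec d,
      D.f v * (D.condPair (remr m s t θ₀ (h ^ 2)) a v / h ^ 2)
      = D.f v * D.remR (remr m s t) H t θ₀ (h ^ 2) a v
        + 1 / 2 * (D.f v * quadForm (H a v θ₀ t) t) := by
    intro h hh a v
    rw [condPair_remr_eq (H := H) (by positivity : 0 < h ^ 2)]
    field_simp
  rw [← integral_quadForm hG₀i, ← integral_const_mul]
  refine tendsto_integral_kernelLaw hd hC Population.lawW_absolutelyContinuous D.isClosed_supp
    Population.ae_mem_supp
    (φ := fun h a v => D.f v * (D.condPair (remr m s t θ₀ (h ^ 2)) a v / h ^ 2))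
    (G := fun a => G a + 1 / 2 * G' a) ?_ ?_ (hG.add (hG'.const_mul _))
    ((integrable_quadForm hG₀i t).const_mul _) ?_ ?_
  · filter_upwards [hsq.eventually (hM.eventually_mem t)] with h ht
    have h1 := (D.stronglyMeasurable_condPair (measurable_remr hM hs ht).stronglyMeasurable).measurable
    have h2 : Measurable fun q : RVec d × RVec d =>
        D.condPair (remr m s t θ₀ (h ^ 2)) q.1 (q.1 - h • q.2) :=
      h1.comp (g := fun q : RVec d × RVec d => D.condPair (remr m s t θ₀ (h ^ 2)) q.1 q.2)
        (f := fun q : RVec d × RVec d => (q.1, q.1 - h • q.2)) (by fun_prop)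
    have h3 : Measurable fun q : RVec d × RVec d => D.f (q.1 - h • q.2) := by fun_prop
    exact (h3.mul (h2.div_const _)).aestronglyMeasurable
  · intro h a v hv
    rw [D.f_eq_zero_of_notMem hv, zero_mul]
  · filter_upwards [hsq.eventually (Ioo_mem_nhdsGT hδ), self_mem_nhdsWithin] with h hhδ hh
    filter_upwards [hGr, hGH] with a h1 h2 v hv
    rw [hsplit h hh]
    refine (abs_add_le _ _).trans (add_le_add ?_ ?_)
    · rw [abs_mul, abs_of_nonneg (D.f_nonneg v)]
      exact h1 _ hhδ v hv
    · rw [abs_mul, abs_mul, abs_of_nonneg (D.f_nonneg v), abs_of_nonneg (by norm_num)]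
      exact mul_le_mul_of_nonneg_left (h2 v hv) (by norm_num)
  · filter_upwards [hs.rem_lim_R t, hM.tendsto_f, tendsto_f_mul_quadForm hM hG₀] with a h1 h2 h3
    have hle : 𝓝[D.supp \ {a}] a ≤ 𝓝[D.supp] a := nhdsWithin_mono a Set.sdiff_subset
    have h4 : Tendsto (fun p : ℝ × RVec d => (p.1 ^ 2, θ₀, p.2)) (𝓝[>] 0 ×ˢ 𝓝[D.supp \ {a}] a)
        (limTauThetaV D.supp θ₀ a) :=
      (hsq.comp tendsto_fst).prodMk (tendsto_const_nhds.prodMk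
        ((tendsto_id.mono_left hle).comp tendsto_snd))
    have h5 := (((h2.mono_left hle).comp tendsto_snd).mul (h1.comp h4)).add
      ((h3.comp (tendsto_snd (f := 𝓝[>] (0 : ℝ)))).const_mul (1 / 2))
    rw [mul_zero, zero_add] at h5
    refine h5.congr' ?_
    have h6 : ∀ᶠ p : ℝ × RVec d in 𝓝[>] 0 ×ˢ 𝓝[D.supp \ {a}] a, 0 < p.1 :=
      tendsto_fst.eventually self_mem_nhdsWithin
    filter_upwards [h6] with p hp
    exact (hsplit p.1 hp a p.2).symm

/-- The rescaled objective converges pointwise to a quadratic function. -/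
theorem exists_tendsto_rescaled (hd : 0 < d) (hM : ConvergenceOfM D m Θ K θ₀)
    (hs : DerivativeConditions D m s H θ₀)
    (hK : ∫⁻ u, ENNReal.ofReal (‖u‖ ^ 2 * K u) < ⊤) (hψ : SmoothPsi D s θ₀) :
    ∃ (Γ : Matrix (Fin k) (Fin k) ℝ) (β : RVec k), Γ.PosDef ∧ ∀ t : RVec k,
      Tendsto (fun h : ℝ => (h ^ 4)⁻¹ * (D.M m K (θ₀ + h ^ 2 • t) h - D.M m K θ₀ h)) (𝓝[>] 0)
        (𝓝 (1 / 2 * quadForm Γ t + inner ℝ β t)) := by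
  have := hM.isProbabilityMeasure_kernelLaw
  have hθ : θ₀ ∈ Θ := interior_subset hM.θ₀_interior
  have hKm := hM.K_measurable
  obtain ⟨G₀, ξ₀, Ξ₀, hV⟩ := hs.variance
  obtain ⟨G, hG, hGψ⟩ := hψ.exists_bound
  have hS : ∀ h : ℝ, 0 < h → _ := fun h hh => D.integral_kernel_smul_eq (g := fun x y => s x y θ₀)
    (hs.s_measurable θ₀).stronglyMeasurable hs.integrable_s hM.K_measurable hM.K_nonneg
    hM.K_bounded hh
  have hK2 : Integrable (fun u => ‖u‖ ^ 2) (kernelLaw K) := by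
    refine ⟨by fun_prop, (hasFiniteIntegral_iff_ofReal (Eventually.of_forall fun u => by
      positivity)).2 ?_⟩
    rw [kernelLaw, lintegral_withDensity_eq_lintegral_mul _ (by fun_prop) (by fun_prop)]
    refine (lintegral_congr fun u => ?_).trans_lt hK
    rw [Pi.mul_apply, mul_comm, ENNReal.ofReal_mul (by positivity)]
  obtain ⟨β, hβ⟩ := tendsto_integral_second_order hKm hM.K_symm hK2 hs.stronglyMeasurable_ψ
    (by filter_upwards [self_mem_nhdsWithin] with h hh using (hS h hh).2.1)
    (hψ.integrable_diag hs) (integral_ψ_diag_eq_zero hd hM hs hψ) hψ.1 hG hGψ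
  refine ⟨_, β, hV.Γ₀_posDef, fun t => ?_⟩
  have h1 := (tendsto_integral_remr hd hM hs hV.G₀_integrable (hV.G₀_lim t)).add
    (hβ.inner (𝕜 := ℝ) (tendsto_const_nhds (x := t)))
  have hsq := tendsto_sq_nhdsGT_zero
  refine h1.congr' ?_
  filter_upwards [hsq.eventually (hM.eventually_mem t), self_mem_nhdsWithin] with h ht hh
  have hh : 0 < h := hh
  have hh2 : 0 < h ^ 2 := by positivity
  obtain ⟨j1, -, -⟩ := D.integral_kernel_smul_eq (g := fun x y => m x y (θ₀ + h ^ 2 • t))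
    (hM.m_measurable _ ht).stronglyMeasurable (hM.m_integrable _ ht) hKm hM.K_nonneg hM.K_bounded hh
  obtain ⟨j2, -, -⟩ := D.integral_kernel_smul_eq (g := fun x y => m x y θ₀)
    (hM.m_measurable _ hθ).stronglyMeasurable (hM.m_integrable _ hθ) hKm hM.K_nonneg hM.K_bounded hh
  obtain ⟨j3, -, e3⟩ := D.integral_kernel_smul_eq (g := remr m s t θ₀ (h ^ 2))
    (measurable_remr hM hs ht).stronglyMeasurable
    (integrable_remr (hM.m_integrable _ ht) (hM.m_integrable _ hθ) hs.integrable_s)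
    hKm hM.K_nonneg hM.K_bounded hh
  obtain ⟨j4, -, e4⟩ := hS h hh
  have hdiff : D.M m K (θ₀ + h ^ 2 • t) h - D.M m K θ₀ h
      = h ^ 2 * (∫ p, ((h ^ d)⁻¹ * K (h⁻¹ • (D.w p.1 - D.w p.2))) • remr m s t θ₀ (h ^ 2) p.1 p.2
          ∂D.pairLaw
        + inner ℝ (∫ p, ((h ^ d)⁻¹ * K (h⁻¹ • (D.w p.1 - D.w p.2))) • s p.1 p.2 θ₀ ∂D.pairLaw) t) := by
    have e5 : (inner ℝ (∫ p, ((h ^ d)⁻¹ * K (h⁻¹ • (D.w p.1 - D.w p.2))) • s p.1 p.2 θ₀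
        ∂D.pairLaw) t : ℝ)
        = ∫ p, inner ℝ (((h ^ d)⁻¹ * K (h⁻¹ • (D.w p.1 - D.w p.2))) • s p.1 p.2 θ₀) t
        ∂D.pairLaw := by
      rw [real_inner_comm, ← integral_inner j4]
      simp_rw [real_inner_comm]
    rw [e5, ← integral_add j3 (j4.inner_const t), ← integral_const_mul]
    simp only [smul_eq_mul, mul_comm ((h ^ d)⁻¹ * K _)] at j1 j2
    rw [Population.M, Population.M, ← integral_sub j1 j2]
    refine integral_congr_ae (Eventually.of_forall fun p => ?_)
    simp only [remr, real_inner_smul_left, smul_eq_mul]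
    field_simp
    ring
  rw [hdiff, e3, e4]
  have e6 : ∫ q, D.f (q.1 - h • q.2) * (D.condPair (remr m s t θ₀ (h ^ 2)) q.1 (q.1 - h • q.2)
      / h ^ 2) ∂D.lawW.prod (kernelLaw K) = (∫ q, D.f (q.1 - h • q.2) •
      D.condPair (remr m s t θ₀ (h ^ 2)) q.1 (q.1 - h • q.2) ∂D.lawW.prod (kernelLaw K)) / h ^ 2 := by
    rw [← integral_div]
    simp only [smul_eq_mul, mul_div_assoc]
  rw [e6, real_inner_smul_left]
  change _ = (h ^ 4)⁻¹ * (h ^ 2 * (_ + inner ℝ (∫ q, D.ψ s θ₀ q.1 (q.1 - h • q.2)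
    ∂D.lawW.prod (kernelLaw K)) t))
  field_simp

lemma ConvergenceOfM.convexOn_M (hM : ConvergenceOfM D m Θ K θ₀) {h : ℝ} (hh : 0 < h) :
    ConvexOn ℝ Θ fun θ => D.M m K θ h := by
  have := hM.isProbabilityMeasure_kernelLaw
  have hi : ∀ θ ∈ Θ, Integrable (fun p : Z × Z =>
      m p.1 p.2 θ * ((h ^ d)⁻¹ * K (h⁻¹ • (D.w p.1 - D.w p.2)))) D.pairLaw := fun θ hθ => by
    have := (D.integral_kernel_smul_eq (g := fun x y => m x y θ)
      (hM.m_measurable _ hθ).stronglyMeasurable (hM.m_integrable _ hθ) hM.K_measurable hM.K_nonneg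
      hM.K_bounded hh).1
    simpa only [smul_eq_mul, mul_comm ((h ^ d)⁻¹ * K _)] using this
  refine ⟨hM.Θ_convex, fun x hx y hy a b ha hb hab => ?_⟩
  simp only [Population.M, smul_eq_mul]
  rw [← integral_const_mul, ← integral_const_mul,
    ← integral_add ((hi x hx).const_mul a) ((hi y hy).const_mul b)]
  refine integral_mono_ae (hi _ (hM.Θ_convex hx hy ha hb hab))
    (((hi x hx).const_mul a).add ((hi y hy).const_mul b)) ?_
  filter_upwards [hM.m_convex] with p hp
  have h1 := hp.2 hx hy ha hb hab
  have h2 : 0 ≤ (h ^ d)⁻¹ * K (h⁻¹ • (D.w p.1 - D.w p.2)) :=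
    mul_nonneg (by positivity) (hM.K_nonneg _)
  have h3 := mul_le_mul_of_nonneg_right h1 h2
  simp only [smul_eq_mul] at h3
  linarith

/-! ### Minimizing the limiting quadratic -/

lemma quadForm_eq_dotProduct (A : Matrix (Fin k) (Fin k) ℝ) (t : RVec k) :
    quadForm A t = t.ofLp ⬝ᵥ A.mulVec t.ofLp := by
  simp only [quadForm, dotProduct, Matrix.mulVec, Finset.mul_sum, mul_assoc]

/-- A quadratic function with positive definite leading part has a unique minimizer. -/
lemma exists_unique_min_quadratic {Γ : Matrix (Fin k) (Fin k) ℝ} (hΓ : Γ.PosDef) (β : RVec k) :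
    ∃ x : RVec k, ∀ t, t ≠ x →
      1 / 2 * quadForm Γ x + inner ℝ β x < 1 / 2 * quadForm Γ t + inner ℝ β t := by
  refine ⟨WithLp.toLp 2 (-(Γ⁻¹.mulVec β.ofLp)), fun t ht => ?_⟩
  set x : Fin k → ℝ := -(Γ⁻¹.mulVec β.ofLp) with hx
  have hΓx : Γ.mulVec x = -β.ofLp := by
    rw [hx, Matrix.mulVec_neg, Matrix.mulVec_mulVec,
      Matrix.mul_nonsing_inv _ ((Matrix.isUnit_iff_isUnit_det _).1 hΓ.isUnit), Matrix.one_mulVec]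
  have hy0 : t.ofLp - x ≠ 0 := fun h => ht (by
    rw [← sub_eq_zero.1 h])
  -- Since `Γx = -β`, the values at `t` and `x` differ by `½ (t - x)'Γ(t - x)`.
  have hpos := hΓ.dotProduct_mulVec_pos hy0
  have hsymm : x ⬝ᵥ Γ.mulVec t.ofLp = t.ofLp ⬝ᵥ Γ.mulVec x := by
    rw [Matrix.dotProduct_mulVec, ← Matrix.mulVec_transpose, dotProduct_comm]
    have : Γ.transpose = Γ := by simpa using hΓ.isHermitian.eq
    rw [this]
  have hin : ∀ y : RVec k, (inner ℝ β y : ℝ) = y.ofLp ⬝ᵥ β.ofLp := fun y => by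
    rw [EuclideanSpace.inner_eq_star_dotProduct]; simp
  simp only [quadForm_eq_dotProduct, hin]
  simp only [star_trivial, Matrix.mulVec_sub, sub_dotProduct, dotProduct_sub, hsymm, hΓx,
    dotProduct_neg] at hpos
  simp only [hΓx, dotProduct_neg]
  linarith

end

end PairwiseDiff

end

/-! ### From rescaled minimizers to the expansion of `θ(h)` -/

theorem proposition1 {d k : ℕ} (hd : 0 < d) {Z : Type*} [MeasurableSpace Z]
    (D : PairwiseDiff.Population d Z)
    (m : Z → Z → PairwiseDiff.RVec k → ℝ) (Θ : Set (PairwiseDiff.RVec k))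
    (K : PairwiseDiff.RVec d → ℝ) (θ₀ : PairwiseDiff.RVec k)
    (s : Z → Z → PairwiseDiff.RVec k → PairwiseDiff.RVec k)
    (H : PairwiseDiff.RVec d → PairwiseDiff.RVec d → PairwiseDiff.RVec k →
      PairwiseDiff.RVec k → Matrix (Fin k) (Fin k) ℝ)
    (hM : PairwiseDiff.ConvergenceOfM D m Θ K θ₀)
    (hs : PairwiseDiff.DerivativeConditions D m s H θ₀)
    (hK : ∫⁻ u, ENNReal.ofReal (‖u‖ ^ 2 * K u) < ⊤)
    (hψ : PairwiseDiff.SmoothPsi D s θ₀) :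
    (∀ᶠ h in 𝓝[>] (0 : ℝ), (D.argminM m Θ K h).Nonempty) ∧
    ∃ b₂ : PairwiseDiff.RVec k, ∀ θ : ℝ → PairwiseDiff.RVec k,
      (∀ᶠ h in 𝓝[>] (0 : ℝ), θ h ∈ D.argminM m Θ K h) →
      (fun h : ℝ => θ h - θ₀ - h ^ 2 • b₂) =o[𝓝[>] (0 : ℝ)] (fun h : ℝ => h ^ 2) := by
  obtain ⟨Γ, β, hΓ, hlim⟩ := PairwiseDiff.exists_tendsto_rescaled hd hM hs hK hψ
  obtain ⟨x, hx⟩ := PairwiseDiff.exists_unique_min_quadratic hΓ β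
  have hpos : ∀ᶠ h in 𝓝[>] (0 : ℝ), 0 < h := self_mem_nhdsWithin
  have hconv : ∀ᶠ h in 𝓝[>] (0 : ℝ), ConvexOn ℝ {t | θ₀ + h ^ 2 • t ∈ Θ}
      fun t => (h ^ 4)⁻¹ * (D.M m K (θ₀ + h ^ 2 • t) h - D.M m K θ₀ h) := by
    filter_upwards [hpos] with h hh
    have h1 : ∀ u v : PairwiseDiff.RVec k, ∀ a b : ℝ, a + b = 1 →
        θ₀ + h ^ 2 • (a • u + b • v) = a • (θ₀ + h ^ 2 • u) + b • (θ₀ + h ^ 2 • v) := by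
      intro u v a b hab
      obtain rfl : b = 1 - a := by linarith
      module
    refine ⟨fun u hu v hv a b ha hb hab => ?_, fun u hu v hv a b ha hb hab => ?_⟩
    · rw [Set.mem_ofPred_eq, h1 u v a b hab]
      exact hM.Θ_convex hu hv ha hb hab
    · have h2 := (hM.convexOn_M hh).2 hu hv ha hb hab
      simp only [smul_eq_mul, h1 u v a b hab] at h2 ⊢
      have h3 : 0 < (h ^ 4)⁻¹ := by positivity
      have h4 := mul_le_mul_of_nonneg_left h2 h3.le
      obtain rfl : b = 1 - a := by linarith
      linarith
  have hC : ∀ R, ∀ᶠ h in 𝓝[>] (0 : ℝ),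
      Metric.ball (0 : PairwiseDiff.RVec k) R ⊆ {t | θ₀ + h ^ 2 • t ∈ Θ} := by
    intro R
    obtain ⟨r, hr, hrΘ⟩ := Metric.mem_nhds_iff.1 (mem_interior_iff_mem_nhds.1 hM.θ₀_interior)
    have h1 : Tendsto (fun h : ℝ => h ^ 2 * R) (𝓝 0) (𝓝 (0 ^ 2 * R)) :=
      Continuous.tendsto (by fun_prop) 0
    rw [zero_pow two_ne_zero, zero_mul] at h1
    filter_upwards [(h1.mono_left nhdsWithin_le_nhds).eventually (eventually_lt_nhds hr), hpos]
      with h hhr hh t ht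
    refine hrΘ ?_
    rw [mem_ball_iff_norm, add_sub_cancel_left, norm_smul, Real.norm_of_nonneg (by positivity)]
    have h2 : h ^ 2 * ‖t‖ ≤ h ^ 2 * R := by
      gcongr
      exact (mem_ball_zero_iff.1 ht).le
    exact h2.trans_lt hhr
  have hmin : ∀ h : ℝ, 0 < h → ∀ t t' : PairwiseDiff.RVec k,
      (h ^ 4)⁻¹ * (D.M m K (θ₀ + h ^ 2 • t) h - D.M m K θ₀ h)
        ≤ (h ^ 4)⁻¹ * (D.M m K (θ₀ + h ^ 2 • t') h - D.M m K θ₀ h)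
      ↔ D.M m K (θ₀ + h ^ 2 • t) h ≤ D.M m K (θ₀ + h ^ 2 • t') h := by
    intro h hh t t'
    rw [mul_le_mul_iff_right₀ (by positivity), sub_le_sub_iff_right]
  have hcoord : ∀ h : ℝ, 0 < h → ∀ θ : PairwiseDiff.RVec k,
      θ₀ + h ^ 2 • ((h ^ 2)⁻¹ • (θ - θ₀)) = θ := by
    intro h hh θ
    rw [smul_inv_smul₀ (by positivity), add_sub_cancel]
  refine ⟨?_, x, fun θ hθ => ?_⟩
  · filter_upwards [PairwiseDiff.eventually_exists_min_of_convexOn hconv hC hlim hx, hpos]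
      with h ⟨t, ht, htmin⟩ hh
    refine ⟨θ₀ + h ^ 2 • t, ht, fun θ' hθ' => ?_⟩
    have h1 := (hmin h hh _ _).1 (htmin ((h ^ 2)⁻¹ • (θ' - θ₀)) (by
      rw [hcoord h hh]; exact hθ'))
    rwa [hcoord h hh] at h1
  · rw [Asymptotics.isLittleO_iff]
    intro ε hε
    filter_upwards [PairwiseDiff.eventually_lt_of_convexOn hconv hC hlim hx hε, hθ, hpos,
      hC (‖x‖ + 1)] with h hlt hθh hh hxC
    have hxΘ : θ₀ + h ^ 2 • x ∈ Θ := hxC (by simp)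
    set t := (h ^ 2)⁻¹ • (θ h - θ₀) with ht
    have ht' : θ₀ + h ^ 2 • t = θ h := hcoord h hh _
    -- At distance at least `ε` from `x` the rescaled objective exceeds its value at `x`, so no
    -- minimizer lies there.
    have h1 : ‖t - x‖ < ε := by
      by_contra! hcon
      refine absurd (hlt t (show θ₀ + h ^ 2 • t ∈ Θ by rw [ht']; exact hθh.1) hcon) (not_lt.2 ?_)
      rw [hmin h hh, ht']
      exact hθh.2 _ hxΘ
    have h2 : θ h - θ₀ - h ^ 2 • x = h ^ 2 • (t - x) := by
      rw [← ht']; module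
    rw [h2, norm_smul, mul_comm]
    gcongr
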